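/- Let $k$ be a field, $\Gamma$ a finite group, and $R$ a Hopf algebra in the category of (left) Yetter–Drinfeld modules over the group algebra $k\Gamma$, with coaction $\delta$. Let $P(R)=\{x\in R : \Delta(x)=1\otimes x+x\otimes 1\}$ be its space of primitive elements. Assume that $R$ is an ET-algebra, that is, the coradical of $R$ (the sum of its simple subcoalgebras) is $k1$ and $P(R)$ generates $R$ as an algebra, and assume that $\dim_k P(R)=2$. Then $R$ can be obtained from the abelian case: there are an abelian subgroup $\Gamma_1\le\Gamma$ such that $\delta(R)\subseteq k\Gamma_1\otimes R$ and $R$, with its action restricted to $\Gamma_1$, is a Hopf algebra in the category of Yetter–Drinfeld modules over $k\Gamma_1$, a group $\Gamma_2$, and an exact sequence of Hopf algebras $$k\longrightarrow R\# k\Gamma_1\overset{\iota}{\longrightarrow} R\# k\Gamma\overset{\pi}{\longrightarrow} k\Gamma_2\longrightarrow k,$$ where $R\# k\Gamma_1$ and $R\# k\Gamma$ are the bosonizations of $R$ and $\iota(r\# h)=r\# h$ is the inclusion. Here exactness of a sequence $k\to A\overset{\iota}{\to}C\overset{\pi}{\to}B\to k$ of Hopf algebras means that $\iota$ is injective, $\pi$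 is surjective, $\ker\pi=C\,\iota(A)^+=\iota(A)^+C$ with $\iota(A)^+=\iota(\ker\varepsilon_A)$, and $$\iota(A)=\{c\in C : (\mathrm{id}\otimes\pi)\Delta(c)=c\otimes 1\}=\{c\in C : (\pi\otimes\mathrm{id})\Delta(c)=1\otimes c\}.$$ -/

import Mathlib

open TensorProduct Coalgebra

universe u v w w'

noncomputable section

/-! ### Yetter-Drinfeld modules over a group algebra -/

/-- A (left-left) Yetter-Drinfeld module over the Hopf algebra `H = kΓ` with underlying vector
space `V`: a left `H`-module (a representation of `Γ`) which is also a left `H`-comodule, such that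
`δ (h • m) = h₁ m₍₋₁₎ S(h₃) ⊗ h₂ • m₍₀₎`. The last condition is linear in `h`, and for a group
element `h = g` it reads `δ (g • m) = g m₍₋₁₎ g⁻¹ ⊗ g • m₍₀₎`. -/
structure YDModule (k : Type u) (Γ : Type v) (V : Type w) [Field k] [Group Γ]
    [AddCommGroup V] [Module k V] where
  /-- the action of `Γ`, i.e. the `kΓ`-module structure -/
  act : Representation k Γ V
  /-- the coaction `δ` -/
  coact : V →ₗ[k] MonoidAlgebra k Γ ⊗[k] V
  coact_coassoc :
    coact.lTensor (MonoidAlgebra k Γ) ∘ₗ coact =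
      (TensorProduct.assoc k _ _ _).toLinearMap ∘ₗ
        (comul (R := k) (A := MonoidAlgebra k Γ)).rTensor V ∘ₗ coact
  coact_counit :
    (TensorProduct.lid k V).toLinearMap ∘ₗ
      (counit (R := k) (A := MonoidAlgebra k Γ)).rTensor V ∘ₗ coact = LinearMap.id
  coact_act : ∀ (g : Γ) (m : V),
    coact (act g m) =
      TensorProduct.map
        (LinearMap.mulLeft k (MonoidAlgebra.single g (1 : k)) ∘ₗ
          LinearMap.mulRight k (MonoidAlgebra.single g⁻¹ (1 : k)))
        (act g) (coact m)

/-- `(a ⊗ b) ⊗ (c ⊗ d) ↦ a ⊗ f (b ⊗ c) ⊗ d`, i.e. the map `id ⊗ f ⊗ id`. -/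
def middleMap (k : Type u) [Field k] (A D : Type*) {B C B' C' : Type*}
    [AddCommGroup A] [Module k A] [AddCommGroup B] [Module k B] [AddCommGroup C] [Module k C]
    [AddCommGroup D] [Module k D] [AddCommGroup B'] [Module k B'] [AddCommGroup C'] [Module k C']
    (f : B ⊗[k] C →ₗ[k] C' ⊗[k] B') :
    (A ⊗[k] B) ⊗[k] (C ⊗[k] D) →ₗ[k] (A ⊗[k] C') ⊗[k] (B' ⊗[k] D) :=
  (TensorProduct.assoc k A C' (B' ⊗[k] D)).symm.toLinearMap ∘ₗ
    LinearMap.lTensor A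
      ((TensorProduct.assoc k C' B' D).toLinearMap ∘ₗ f.rTensor D ∘ₗ
        (TensorProduct.assoc k B C D).symm.toLinearMap) ∘ₗ
    (TensorProduct.assoc k A B (C ⊗[k] D)).toLinearMap

namespace YDModule

variable {k : Type u} {Γ : Type v} [Field k] [Group Γ]
variable {V : Type w} [AddCommGroup V] [Module k V] {W : Type w'} [AddCommGroup W] [Module k W]

/-- The action as a linear map `kΓ ⊗ V → V`. -/
def actMap (X : YDModule k Γ V) : MonoidAlgebra k Γ ⊗[k] V →ₗ[k] V :=
  TensorProduct.lift X.act.asAlgebraHom.toLinearMap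

/-- The morphisms of the category of Yetter-Drinfeld modules: linear and colinear maps. -/
structure IsHom (X : YDModule k Γ V) (Y : YDModule k Γ W) (f : V →ₗ[k] W) : Prop where
  map_act : ∀ (g : Γ) (m : V), f (X.act g m) = Y.act g (f m)
  map_coact : Y.coact ∘ₗ f = f.lTensor (MonoidAlgebra k Γ) ∘ₗ X.coact

/-- The braiding `c (m ⊗ n) = m₍₋₁₎ • n ⊗ m₍₀₎`. -/
def braiding (X : YDModule k Γ V) (Y : YDModule k Γ W) : V ⊗[k] W →ₗ[k] W ⊗[k] V :=
  Y.actMap.rTensor V ∘ₗ (TensorProduct.rightComm k (MonoidAlgebra k Γ) V W).toLinearMap ∘ₗ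
    X.coact.rTensor W

theorem actMap_single (X : YDModule k Γ V) (g : Γ) (m : V) :
    X.actMap (MonoidAlgebra.single g 1 ⊗ₜ m) = X.act g m := by
  simp [actMap]

/-- `m` is homogeneous of degree `g`. -/
def IsHomog (X : YDModule k Γ V) (g : Γ) (m : V) : Prop :=
  X.coact m = MonoidAlgebra.single g 1 ⊗ₜ m

theorem IsHomog.act {X : YDModule k Γ V} {g : Γ} {m : V} (h : X.IsHomog g m) (x : Γ) :
    X.IsHomog (x * g * x⁻¹) (X.act x m) := by
  unfold IsHomog at *
  rw [X.coact_act, h]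
  simp [mul_assoc]

theorem exists_sum {Γ : Type v} (t : MonoidAlgebra k Γ ⊗[k] V) :
    ∃ f : Γ →₀ V, t = f.sum fun g m => MonoidAlgebra.single g (1 : k) ⊗ₜ[k] m := by
  induction t with
  | zero => exact ⟨0, by simp⟩
  | add x y hx hy =>
    obtain ⟨f, rfl⟩ := hx
    obtain ⟨f', rfl⟩ := hy
    exact ⟨f + f', by rw [Finsupp.sum_add_index'] <;> simp [tmul_add]⟩
  | tmul x m =>
    induction x using MonoidAlgebra.induction_linear with
    | zero => exact ⟨0, by simp⟩
    | add x y hx hy =>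
      obtain ⟨f, hx⟩ := hx
      obtain ⟨f', hy⟩ := hy
      refine ⟨f + f', ?_⟩
      rw [Finsupp.sum_add_index', add_tmul, hx, hy] <;> simp [tmul_add]
    | single g a =>
      refine ⟨Finsupp.single g (a • m), ?_⟩
      rw [Finsupp.sum_single_index (by simp), tmul_smul, smul_tmul']
      simp

theorem span_homog (X : YDModule k Γ V) :
    Submodule.span k {m | ∃ g, X.IsHomog g m} = ⊤ := by
  classical
  rw [eq_top_iff]
  intro v _
  obtain ⟨f, hf⟩ := exists_sum (X.coact v)
  have h1 := LinearMap.congr_fun X.coact_counit v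
  have h2 := LinearMap.congr_fun X.coact_coassoc v
  simp only [LinearMap.comp_apply, hf, Finsupp.sum, map_sum] at h1 h2
  simp only [LinearMap.lTensor_tmul, LinearMap.rTensor_tmul, MonoidAlgebra.comul_single,
    MonoidAlgebra.counit_single, CommSemiring.comul_apply, TensorProduct.map_tmul,
    MonoidAlgebra.lsingle_apply, LinearEquiv.coe_coe, TensorProduct.assoc_tmul,
    TensorProduct.lid_tmul, CommSemiring.counit_apply, one_smul, LinearMap.id_apply] at h1 h2
  rw [← h1]
  refine Submodule.sum_mem _ fun g hg => Submodule.subset_span ⟨g, ?_⟩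
  have h3 := congrArg ((TensorProduct.lid k _).toLinearMap ∘ₗ LinearMap.rTensor _
    (Finsupp.lapply g ∘ₗ (MonoidAlgebra.coeffLinearEquiv k).toLinearMap)) h2
  simp only [map_sum, LinearMap.comp_apply, LinearMap.rTensor_tmul, LinearEquiv.coe_coe,
    TensorProduct.lid_tmul, MonoidAlgebra.coeffLinearEquiv_apply, MonoidAlgebra.coeff_single,
    Finsupp.lapply_apply, Finsupp.single_apply, ite_smul, one_smul, zero_smul,
    Finset.sum_ite_eq', if_pos hg] at h3
  exact h3

theorem hom_ext {M : Type*} [AddCommGroup M] [Module k M] (X : YDModule k Γ V)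
    {f f' : V →ₗ[k] M} (h : ∀ g m, X.IsHomog g m → f m = f' m) : f = f' :=
  LinearMap.ext_on X.span_homog fun _ ⟨g, hg⟩ => h g _ hg

theorem hom_ext₂ {M : Type*} [AddCommGroup M] [Module k M] (X : YDModule k Γ V)
    (Y : YDModule k Γ W) {f f' : V ⊗[k] W →ₗ[k] M}
    (h : ∀ g m g' n, X.IsHomog g m → Y.IsHomog g' n → f (m ⊗ₜ n) = f' (m ⊗ₜ n)) : f = f' :=
  TensorProduct.ext <| X.hom_ext fun g m hm => Y.hom_ext fun g' n hn => h g m g' n hm hn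

theorem homog_induction₂ (X : YDModule k Γ V) (Y : YDModule k Γ W) {p : V ⊗[k] W → Prop}
    (zero : p 0) (add : ∀ x y, p x → p y → p (x + y)) (smul : ∀ (c : k) x, p x → p (c • x))
    (tmul : ∀ g m g' n, X.IsHomog g m → Y.IsHomog g' n → p (m ⊗ₜ n)) (t : V ⊗[k] W) : p t := by
  let N : Submodule k (V ⊗[k] W) :=
    { carrier := {t | p t}, add_mem' := fun hx hy => add _ _ hx hy, zero_mem' := zero,
      smul_mem' := fun c x hx => smul c x hx }
  have h : N.mkQ = 0 := hom_ext₂ X Y fun g m g' n hm hn => by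
    have : m ⊗ₜ n ∈ N := tmul g m g' n hm hn
    simpa [-Submodule.mem_mk] using (Submodule.Quotient.mk_eq_zero N).2 this
  have h' : t ∈ N := by
    rw [← N.ker_mkQ, h]
    simp
  exact h'

theorem braiding_homog (X : YDModule k Γ V) (Y : YDModule k Γ W) {g : Γ} {m : V}
    (hm : X.IsHomog g m) (n : W) : X.braiding Y (m ⊗ₜ n) = Y.act g n ⊗ₜ m := by
  unfold IsHomog at hm
  simp [braiding, hm, actMap_single]

/-- The tensor product of Yetter-Drinfeld modules: diagonal action and codiagonal coaction
`m ⊗ n ↦ m₍₋₁₎ n₍₋₁₎ ⊗ m₍₀₎ ⊗ n₍₀₎`. -/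
def tensorCoact (X : YDModule k Γ V) (Y : YDModule k Γ W) :
    V ⊗[k] W →ₗ[k] MonoidAlgebra k Γ ⊗[k] (V ⊗[k] W) :=
  (LinearMap.mul' k (MonoidAlgebra k Γ)).rTensor (V ⊗[k] W) ∘ₗ
    (TensorProduct.tensorTensorTensorComm k (MonoidAlgebra k Γ) V
      (MonoidAlgebra k Γ) W).toLinearMap ∘ₗ
    TensorProduct.map X.coact Y.coact

theorem tensorCoact_homog (X : YDModule k Γ V) (Y : YDModule k Γ W) {g g' : Γ} {m : V} {n : W}
    (hm : X.IsHomog g m) (hn : Y.IsHomog g' n) :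
    tensorCoact X Y (m ⊗ₜ n) = MonoidAlgebra.single (g * g') 1 ⊗ₜ (m ⊗ₜ n) := by
  unfold IsHomog at hm hn
  simp [tensorCoact, hm, hn]

/-- The tensor product of two Yetter-Drinfeld modules. -/
def tensor (X : YDModule k Γ V) (Y : YDModule k Γ W) : YDModule k Γ (V ⊗[k] W) where
  act := X.act.tprod Y.act
  coact := tensorCoact X Y
  coact_coassoc := by
    refine hom_ext₂ X Y fun g m g' n hm hn => ?_
    simp [tensorCoact_homog X Y hm hn]
  coact_counit := by
    refine hom_ext₂ X Y fun g m g' n hm hn => ?_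
    simp [tensorCoact_homog X Y hm hn]
  coact_act := fun x t => by
    refine LinearMap.congr_fun (f := tensorCoact X Y ∘ₗ (X.act.tprod Y.act) x)
      (g := TensorProduct.map _ _ ∘ₗ tensorCoact X Y) (hom_ext₂ X Y fun g m g' n hm hn => ?_) t
    simp [tensorCoact_homog X Y hm hn, tensorCoact_homog X Y (hm.act x) (hn.act x), mul_assoc]

variable (k Γ) in
/-- The unit object: `k` with trivial action and coaction. -/
def unit : YDModule k Γ k where
  act := Representation.trivial k Γ k
  coact := TensorProduct.mk k (MonoidAlgebra k Γ) k 1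
  coact_coassoc := by ext; simp [MonoidAlgebra.one_def]
  coact_counit := by ext; simp
  coact_act := fun g m => by simp [MonoidAlgebra.one_def]

end YDModule

/-! ### Hopf algebras in the Yetter-Drinfeld category -/

/-- A Hopf algebra in the category of Yetter-Drinfeld modules over `kΓ`: an algebra and coalgebra
`R` with a Yetter-Drinfeld structure such that all structure maps are morphisms in the category,
the counit and the comultiplication are algebra maps (for the braided product
`(m ⊗ m)(id ⊗ c ⊗ id)` of `R ⊗ R`), together with an antipode. -/
structure YDHopfAlgebra (k : Type u) (Γ : Type v) (R : Type w) [Field k] [Group Γ]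
    [Ring R] [Algebra k R] [Coalgebra k R] extends YDModule k Γ R where
  mul_isHom : (toYDModule.tensor toYDModule).IsHom toYDModule (LinearMap.mul' k R)
  one_isHom : (YDModule.unit k Γ).IsHom toYDModule (Algebra.linearMap k R)
  comul_isHom : toYDModule.IsHom (toYDModule.tensor toYDModule) (comul (R := k) (A := R))
  counit_isHom : toYDModule.IsHom (YDModule.unit k Γ) (counit (R := k) (A := R))
  counit_one : counit (R := k) (1 : R) = 1
  counit_mul : ∀ r s : R, counit (R := k) (r * s) = counit (R := k) r * counit (R := k) s
  comul_one : comul (R := k) (1 : R) = 1 ⊗ₜ 1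
  comul_mul :
    comul (R := k) (A := R) ∘ₗ LinearMap.mul' k R =
      TensorProduct.map (LinearMap.mul' k R) (LinearMap.mul' k R) ∘ₗ
        middleMap k R R (toYDModule.braiding toYDModule) ∘ₗ
        TensorProduct.map (comul (R := k) (A := R)) (comul (R := k) (A := R))
  antipode : R →ₗ[k] R
  antipode_isHom : toYDModule.IsHom toYDModule antipode
  mul_antipode_rTensor_comul :
    LinearMap.mul' k R ∘ₗ antipode.rTensor R ∘ₗ comul = Algebra.linearMap k R ∘ₗ counit
  mul_antipode_lTensor_comul :
    LinearMap.mul' k R ∘ₗ antipode.lTensor R ∘ₗ comul = Algebra.linearMap k R ∘ₗ counit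

namespace YDHopfAlgebra

variable {k : Type u} {Γ : Type v} {R : Type w} [Field k] [Group Γ]
  [Ring R] [Algebra k R] [Coalgebra k R]

/-- The map `h ⊗ s ↦ h₁ • s ⊗ h₂`. -/
def twist (B : YDHopfAlgebra k Γ R) :
    MonoidAlgebra k Γ ⊗[k] R →ₗ[k] R ⊗[k] MonoidAlgebra k Γ :=
  B.actMap.rTensor (MonoidAlgebra k Γ) ∘ₗ
    (TensorProduct.rightComm k (MonoidAlgebra k Γ) (MonoidAlgebra k Γ) R).toLinearMap ∘ₗ
    (comul (R := k) (A := MonoidAlgebra k Γ)).rTensor R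

/-- The map `r ⊗ h ↦ r₍₋₁₎ h ⊗ r₍₀₎`. -/
def cotwist (B : YDHopfAlgebra k Γ R) :
    R ⊗[k] MonoidAlgebra k Γ →ₗ[k] MonoidAlgebra k Γ ⊗[k] R :=
  (LinearMap.mul' k (MonoidAlgebra k Γ)).rTensor R ∘ₗ
    (TensorProduct.rightComm k (MonoidAlgebra k Γ) R (MonoidAlgebra k Γ)).toLinearMap ∘ₗ
    B.coact.rTensor (MonoidAlgebra k Γ)

/-- The multiplication `(r # h)(s # t) = r (h₁ • s) # h₂ t` of the bosonization. -/
def smashMul (B : YDHopfAlgebra k Γ R) :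
    (R ⊗[k] MonoidAlgebra k Γ) ⊗[k] (R ⊗[k] MonoidAlgebra k Γ) →ₗ[k]
      R ⊗[k] MonoidAlgebra k Γ :=
  TensorProduct.map (LinearMap.mul' k R) (LinearMap.mul' k (MonoidAlgebra k Γ)) ∘ₗ
    middleMap k R (MonoidAlgebra k Γ) B.twist

/-- The comultiplication `r # h ↦ (r₁ # (r₂)₍₋₁₎ h₁) ⊗ ((r₂)₍₀₎ # h₂)` of the bosonization. -/
def smashComul (B : YDHopfAlgebra k Γ R) :
    R ⊗[k] MonoidAlgebra k Γ →ₗ[k]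
      (R ⊗[k] MonoidAlgebra k Γ) ⊗[k] (R ⊗[k] MonoidAlgebra k Γ) :=
  middleMap k R (MonoidAlgebra k Γ) B.cotwist ∘ₗ
    TensorProduct.map (comul (R := k) (A := R)) (comul (R := k) (A := MonoidAlgebra k Γ))

/-- The counit `r # h ↦ ε(r) ε(h)` of the bosonization. -/
def smashCounit (_ : YDHopfAlgebra k Γ R) : R ⊗[k] MonoidAlgebra k Γ →ₗ[k] k :=
  LinearMap.mul' k k ∘ₗ
    TensorProduct.map (counit (R := k) (A := R)) (counit (R := k) (A := MonoidAlgebra k Γ))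

/-- The antipode of the bosonization, `r # h ↦ (1 # S(r₍₋₁₎ h)) (S_R(r₍₀₎) # 1)`. -/
def smashAntipode (B : YDHopfAlgebra k Γ R) :
    R ⊗[k] MonoidAlgebra k Γ →ₗ[k] R ⊗[k] MonoidAlgebra k Γ :=
  B.twist ∘ₗ
    TensorProduct.map (HopfAlgebra.antipode k (A := MonoidAlgebra k Γ)) B.antipode ∘ₗ B.cotwist

/-- The basic element `r # g` for a group element `g`. -/
abbrev el (_ : YDHopfAlgebra k Γ R) (r : R) (g : Γ) : R ⊗[k] MonoidAlgebra k Γ :=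
  r ⊗ₜ MonoidAlgebra.single g 1

theorem act_one (B : YDHopfAlgebra k Γ R) (g : Γ) : B.act g (1 : R) = 1 := by
  have := B.one_isHom.map_act g 1
  simpa [YDModule.unit] using this.symm

theorem act_mul (B : YDHopfAlgebra k Γ R) (g : Γ) (r s : R) :
    B.act g (r * s) = B.act g r * B.act g s := by
  have := B.mul_isHom.map_act g (r ⊗ₜ s)
  simpa [YDModule.tensor] using this.symm

theorem coact_one (B : YDHopfAlgebra k Γ R) : B.IsHomog 1 1 := by
  have := LinearMap.congr_fun B.one_isHom.map_coact 1
  simpa [YDModule.unit, YDModule.IsHomog, MonoidAlgebra.one_def] using this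

theorem twist_single (B : YDHopfAlgebra k Γ R) (g : Γ) (r : R) :
    B.twist (MonoidAlgebra.single g 1 ⊗ₜ r) = B.el (B.act g r) g := by
  simp [twist, YDModule.actMap_single]

theorem cotwist_homog (B : YDHopfAlgebra k Γ R) {g : Γ} {r : R} (h : B.IsHomog g r) (x : Γ) :
    B.cotwist (B.el r x) = MonoidAlgebra.single (g * x) 1 ⊗ₜ r := by
  unfold YDModule.IsHomog at h
  simp [cotwist, h]

theorem smashMul_el (B : YDHopfAlgebra k Γ R) (r s : R) (g h : Γ) :
    B.smashMul (B.el r g ⊗ₜ B.el s h) = B.el (r * B.act g s) (g * h) := by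
  simp [smashMul, middleMap, twist_single]

theorem ext_el {M : Type*} [AddCommGroup M] [Module k M] (B : YDHopfAlgebra k Γ R)
    {f f' : R ⊗[k] MonoidAlgebra k Γ →ₗ[k] M} (h : ∀ r g, f (B.el r g) = f' (B.el r g)) :
    f = f' := by
  ext r g
  exact h r g

theorem el_induction (B : YDHopfAlgebra k Γ R) {p : R ⊗[k] MonoidAlgebra k Γ → Prop}
    (zero : p 0) (add : ∀ x y, p x → p y → p (x + y)) (smul : ∀ (c : k) x, p x → p (c • x))
    (el : ∀ r g, p (B.el r g)) (t : R ⊗[k] MonoidAlgebra k Γ) : p t := by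
  induction t with
  | zero => exact zero
  | add x y hx hy => exact add x y hx hy
  | tmul r x =>
    induction x using MonoidAlgebra.induction_linear with
    | zero => simpa using zero
    | add x y hx hy => simpa [tmul_add] using add _ _ hx hy
    | single g a =>
      have := smul a _ (el r g)
      simpa [YDHopfAlgebra.el, ← tmul_smul] using this

theorem ext_el₂ {M : Type*} [AddCommGroup M] [Module k M] (B : YDHopfAlgebra k Γ R)
    {f f' : (R ⊗[k] MonoidAlgebra k Γ) ⊗[k] (R ⊗[k] MonoidAlgebra k Γ) →ₗ[k] M}
    (h : ∀ r g s h, f (B.el r g ⊗ₜ B.el s h) = f' (B.el r g ⊗ₜ B.el s h)) : f = f' := by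
  refine TensorProduct.ext' fun a b => ?_
  induction a using B.el_induction with
  | zero => simp
  | add x y hx hy => simp only [map_add, add_tmul, hx, hy]
  | smul a x hx => simp only [map_smul, ← smul_tmul', hx]
  | el r g =>
  induction b using B.el_induction with
  | zero => simp
  | add x y hx hy => simp only [map_add, tmul_add, hx, hy]
  | smul a x hx => simp only [map_smul, tmul_smul, hx]
  | el s x => exact h _ _ _ _

theorem ext_homog {M : Type*} [AddCommGroup M] [Module k M] (B : YDHopfAlgebra k Γ R)
    {f f' : R ⊗[k] MonoidAlgebra k Γ →ₗ[k] M}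
    (h : ∀ b r g, B.IsHomog b r → f (B.el r g) = f' (B.el r g)) :
    f = f' :=
  B.ext_el fun r g => LinearMap.congr_fun (f := f ∘ₗ (TensorProduct.mk k _ _).flip
    (MonoidAlgebra.single g (1 : k))) (g := f' ∘ₗ (TensorProduct.mk k _ _).flip
    (MonoidAlgebra.single g (1 : k))) (B.hom_ext fun b r hr => h b r g hr) r

theorem smashMul_assoc (B : YDHopfAlgebra k Γ R) (a b c : R ⊗[k] MonoidAlgebra k Γ) :
    B.smashMul (B.smashMul (a ⊗ₜ b) ⊗ₜ c) = B.smashMul (a ⊗ₜ B.smashMul (b ⊗ₜ c)) := by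
  have h : B.smashMul ∘ₗ B.smashMul.rTensor _ = B.smashMul ∘ₗ B.smashMul.lTensor _ ∘ₗ
      (TensorProduct.assoc k _ _ _).toLinearMap := by
    refine TensorProduct.ext_threefold fun a b c => ?_
    simp only [LinearMap.comp_apply, LinearMap.rTensor_tmul, LinearMap.lTensor_tmul,
      LinearEquiv.coe_coe, TensorProduct.assoc_tmul]
    induction a using B.el_induction with
    | zero => simp
    | add x y hx hy => simp only [map_add, add_tmul, hx, hy]
    | smul a x hx => simp only [map_smul, ← smul_tmul', hx]
    | el r g =>
    induction b using B.el_induction with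
    | zero => simp
    | add x y hx hy => simp only [map_add, add_tmul, tmul_add, hx, hy]
    | smul a x hx => simp only [map_smul, tmul_smul, ← smul_tmul', hx]
    | el s h =>
    induction c using B.el_induction with
    | zero => simp
    | add x y hx hy => simp only [map_add, tmul_add, hx, hy]
    | smul a x hx => simp only [map_smul, tmul_smul, hx]
    | el t x => simp [smashMul_el, act_mul, mul_assoc]
  exact LinearMap.congr_fun h ((a ⊗ₜ b) ⊗ₜ c)

theorem smul_smashMul (B : YDHopfAlgebra k Γ R) (c : k) (a b : R ⊗[k] MonoidAlgebra k Γ) :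
    B.smashMul ((c • a) ⊗ₜ b) = c • B.smashMul (a ⊗ₜ b) := by
  rw [← smul_tmul', map_smul]

theorem smashMul_smul (B : YDHopfAlgebra k Γ R) (c : k) (a b : R ⊗[k] MonoidAlgebra k Γ) :
    B.smashMul (a ⊗ₜ (c • b)) = c • B.smashMul (a ⊗ₜ b) := by
  rw [tmul_smul, map_smul]

theorem one_smashMul (B : YDHopfAlgebra k Γ R) (a : R ⊗[k] MonoidAlgebra k Γ) :
    B.smashMul (B.el 1 1 ⊗ₜ a) = a := by
  have h : B.smashMul ∘ₗ TensorProduct.mk k _ _ (B.el 1 1) = LinearMap.id := by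
    refine B.ext_el fun r g => ?_
    simp [smashMul_el]
  exact LinearMap.congr_fun h a

theorem smashMul_one (B : YDHopfAlgebra k Γ R) (a : R ⊗[k] MonoidAlgebra k Γ) :
    B.smashMul (a ⊗ₜ B.el 1 1) = a := by
  have h : B.smashMul ∘ₗ (TensorProduct.mk k _ _).flip (B.el 1 1) = LinearMap.id := by
    refine B.ext_el fun r g => ?_
    simp [smashMul_el, act_one]
  exact LinearMap.congr_fun h a

/-- Auxiliary map `r₁ ⊗ v ↦ (r₁ # v₍₋₁₎ g) ⊗ v₍₀₎`. -/
def auxA {V : Type*} [AddCommGroup V] [Module k V] (X : YDModule k Γ V) (R : Type*)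
    [AddCommGroup R] [Module k R] (g : Γ) : R ⊗[k] V →ₗ[k] (R ⊗[k] MonoidAlgebra k Γ) ⊗[k] V :=
  (TensorProduct.assoc k _ _ _).symm.toLinearMap ∘ₗ
    LinearMap.lTensor R
      ((LinearMap.mulRight k (MonoidAlgebra.single g (1 : k))).rTensor V ∘ₗ X.coact)

theorem auxA_homog {R : Type w} [AddCommGroup R] [Module k R] {V : Type*} [AddCommGroup V] [Module k V] (X : YDModule k Γ V) (g : Γ) (r : R)
    {b : Γ} {v : V} (h : X.IsHomog b v) :
    auxA X R g (r ⊗ₜ v) = (r ⊗ₜ MonoidAlgebra.single (b * g) 1) ⊗ₜ v := by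
  unfold YDModule.IsHomog at h
  simp [auxA, h]

/-- Auxiliary map `r₁ ⊗ r₂ ↦ (r₁ # (r₂)₍₋₁₎ g) ⊗ ((r₂)₍₀₎ # g)`. -/
def auxB (B : YDHopfAlgebra k Γ R) (g : Γ) :
    R ⊗[k] R →ₗ[k] (R ⊗[k] MonoidAlgebra k Γ) ⊗[k] (R ⊗[k] MonoidAlgebra k Γ) :=
  LinearMap.lTensor _ ((TensorProduct.mk k R (MonoidAlgebra k Γ)).flip
    (MonoidAlgebra.single g 1)) ∘ₗ auxA B.toYDModule R g

theorem auxB_homog (B : YDHopfAlgebra k Γ R) (g : Γ) (r : R) {b : Γ} {s : R}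
    (h : B.IsHomog b s) : B.auxB g (r ⊗ₜ s) = B.el r (b * g) ⊗ₜ B.el s g := by
  simp [auxB, auxA_homog _ _ _ h]

theorem smashComul_el (B : YDHopfAlgebra k Γ R) (r : R) (g : Γ) :
    B.smashComul (B.el r g) = B.auxB g (comul r) := by
  have h : middleMap k R (MonoidAlgebra k Γ) B.cotwist ∘ₗ (TensorProduct.mk k (R ⊗[k] R) (MonoidAlgebra k Γ ⊗[k] MonoidAlgebra k Γ)).flip
      (MonoidAlgebra.single g (1 : k) ⊗ₜ MonoidAlgebra.single g (1 : k)) = B.auxB g := by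
    refine YDModule.hom_ext₂ (M := (R ⊗[k] MonoidAlgebra k Γ) ⊗[k] (R ⊗[k] MonoidAlgebra k Γ))
      B.toYDModule B.toYDModule fun b r c s hr hs => ?_
    rw [auxB_homog _ _ _ hs]
    simp [middleMap, cotwist_homog B hs]
  rw [← h]
  simp [smashComul]

theorem counit_act (B : YDHopfAlgebra k Γ R) (g : Γ) (r : R) :
    counit (R := k) (B.act g r) = counit (R := k) r := by
  simpa [YDModule.unit] using B.counit_isHom.map_act g r

theorem counit_homog (B : YDHopfAlgebra k Γ R) {g : Γ} {r : R} (h : B.IsHomog g r) :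
    counit (R := k) r = 0 ∨ g = 1 := by
  classical
  have := LinearMap.congr_fun B.counit_isHom.map_coact r
  unfold YDModule.IsHomog at h
  simp only [YDModule.unit, LinearMap.comp_apply, h, LinearMap.lTensor_tmul,
    TensorProduct.mk_apply] at this
  have h2 := congrArg ((TensorProduct.lid k _).toLinearMap ∘ₗ LinearMap.rTensor _
    (Finsupp.lapply (1 : Γ) ∘ₗ (MonoidAlgebra.coeffLinearEquiv k).toLinearMap)) this
  by_cases hg : g = 1
  · exact Or.inr hg
  · left
    simpa [MonoidAlgebra.one_def, Finsupp.single_apply, hg] using h2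

theorem comul_homog (B : YDHopfAlgebra k Γ R) {g : Γ} {r : R} (h : B.IsHomog g r) :
    (B.tensor B.toYDModule).IsHomog g (comul r) := by
  have := LinearMap.congr_fun B.comul_isHom.map_coact r
  unfold YDModule.IsHomog at *
  simpa [h] using this

theorem antipode_homog (B : YDHopfAlgebra k Γ R) {g : Γ} {r : R} (h : B.IsHomog g r) :
    B.IsHomog g (B.antipode r) := by
  have := LinearMap.congr_fun B.antipode_isHom.map_coact r
  unfold YDModule.IsHomog at *
  simpa [h] using this

theorem tensor_homog (B : YDHopfAlgebra k Γ R) {g h : Γ} {r s : R} (hr : B.IsHomog g r)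
    (hs : B.IsHomog h s) : (B.tensor B.toYDModule).IsHomog (g * h) (r ⊗ₜ s) :=
  YDModule.tensorCoact_homog _ _ hr hs

theorem mul_homog (B : YDHopfAlgebra k Γ R) {g h : Γ} {r s : R} (hr : B.IsHomog g r)
    (hs : B.IsHomog h s) : B.IsHomog (g * h) (r * s) := by
  have := LinearMap.congr_fun B.mul_isHom.map_coact (r ⊗ₜ s)
  have h2 := B.tensor_homog hr hs
  unfold YDModule.IsHomog at *
  simpa [h2] using this

theorem smashComul_coassoc (B : YDHopfAlgebra k Γ R) :
    (TensorProduct.assoc k _ _ _).toLinearMap ∘ₗ B.smashComul.rTensor _ ∘ₗ B.smashComul =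
      B.smashComul.lTensor _ ∘ₗ B.smashComul := by
  refine B.ext_el (M := (R ⊗[k] MonoidAlgebra k Γ) ⊗[k] ((R ⊗[k] MonoidAlgebra k Γ) ⊗[k]
    (R ⊗[k] MonoidAlgebra k Γ))) fun r g => ?_
  let P : R ⊗[k] (R ⊗[k] R) →ₗ[k] (R ⊗[k] MonoidAlgebra k Γ) ⊗[k]
      ((R ⊗[k] MonoidAlgebra k Γ) ⊗[k] (R ⊗[k] MonoidAlgebra k Γ)) :=
    LinearMap.lTensor _ (B.auxB g) ∘ₗ auxA (B.tensor B.toYDModule) R g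
  have h1 : ∀ x, B.smashComul.lTensor _ (B.auxB g x) =
      P ((comul (R := k) (A := R)).lTensor R x) := by
    refine LinearMap.congr_fun (f := B.smashComul.lTensor _ ∘ₗ B.auxB g)
      (g := P ∘ₗ (comul (R := k) (A := R)).lTensor R) ?_
    refine YDModule.hom_ext₂ (M := (R ⊗[k] MonoidAlgebra k Γ) ⊗[k] ((R ⊗[k] MonoidAlgebra k Γ) ⊗[k]
      (R ⊗[k] MonoidAlgebra k Γ))) B.toYDModule B.toYDModule fun b r c s hr hs => ?_
    simp only [LinearMap.comp_apply, auxB_homog _ _ _ hs, LinearMap.lTensor_tmul, smashComul_el, P,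
      auxA_homog _ _ _ (B.comul_homog hs)]
  have h2 : ∀ x, TensorProduct.assoc k _ _ _ (B.smashComul.rTensor _ (B.auxB g x)) =
      P (TensorProduct.assoc k _ _ _ ((comul (R := k) (A := R)).rTensor R x)) := by
    refine LinearMap.congr_fun
      (f := (TensorProduct.assoc k _ _ _).toLinearMap ∘ₗ B.smashComul.rTensor _ ∘ₗ B.auxB g)
      (g := P ∘ₗ (TensorProduct.assoc k _ _ _).toLinearMap ∘ₗ
        (comul (R := k) (A := R)).rTensor R) ?_
    refine YDModule.hom_ext₂ (M := (R ⊗[k] MonoidAlgebra k Γ) ⊗[k] ((R ⊗[k] MonoidAlgebra k Γ) ⊗[k]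
      (R ⊗[k] MonoidAlgebra k Γ))) B.toYDModule B.toYDModule fun b r c s hr hs => ?_
    simp only [LinearMap.comp_apply, auxB_homog _ _ _ hs, LinearMap.rTensor_tmul, smashComul_el]
    generalize comul (R := k) r = y
    induction y using YDModule.homog_induction₂ B.toYDModule B.toYDModule with
    | zero => simp
    | add x y hx hy => simp only [map_add, add_tmul, hx, hy]
    | smul a x hx => simp only [map_smul, ← smul_tmul', hx]
    | tmul d m e n hm hn =>
      simp [P, auxB_homog _ _ _ hn, auxA_homog _ _ _ (B.tensor_homog hn hs), auxB_homog _ _ _ hs,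
        mul_assoc]
  simp only [LinearMap.comp_apply, smashComul_el, LinearEquiv.coe_coe]
  rw [h1, h2, Coalgebra.coassoc_apply]

theorem smash_counit_comul (B : YDHopfAlgebra k Γ R) :
    B.smashCounit.rTensor _ ∘ₗ B.smashComul = TensorProduct.mk k k (R ⊗[k] MonoidAlgebra k Γ) 1 := by
  refine B.ext_el (M := k ⊗[k] (R ⊗[k] MonoidAlgebra k Γ)) fun r g => ?_
  have h : ∀ x, B.smashCounit.rTensor _ (B.auxB g x) = LinearMap.lTensor k
      ((TensorProduct.mk k R (MonoidAlgebra k Γ)).flip (MonoidAlgebra.single g 1))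
        ((counit (R := k) (A := R)).rTensor R x) := by
    intro x
    induction x using YDModule.homog_induction₂ B.toYDModule B.toYDModule with
    | zero => simp
    | add x y hx hy => simp only [map_add, hx, hy]
    | smul a x hx => simp only [map_smul, hx]
    | tmul d m e n hm hn => simp [auxB_homog _ _ _ hn, smashCounit]
  simp only [LinearMap.comp_apply, smashComul_el]
  rw [h, Coalgebra.rTensor_counit_comul]
  simp

theorem smash_comul_counit (B : YDHopfAlgebra k Γ R) :
    B.smashCounit.lTensor _ ∘ₗ B.smashComul = (TensorProduct.mk k (R ⊗[k] MonoidAlgebra k Γ) k).flip 1 := by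
  refine B.ext_el (M := (R ⊗[k] MonoidAlgebra k Γ) ⊗[k] k) fun r g => ?_
  have h : ∀ x, B.smashCounit.lTensor _ (B.auxB g x) = LinearMap.rTensor k
      ((TensorProduct.mk k R (MonoidAlgebra k Γ)).flip (MonoidAlgebra.single g 1))
        ((counit (R := k) (A := R)).lTensor R x) := by
    intro x
    induction x using YDModule.homog_induction₂ B.toYDModule B.toYDModule with
    | zero => simp
    | add x y hx hy => simp only [map_add, hx, hy]
    | smul a x hx => simp only [map_smul, hx]
    | tmul d m e n hm hn =>
      rcases B.counit_homog hn with h | h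
      · simp [auxB_homog _ _ _ hn, smashCounit, h]
      · simp [auxB_homog _ _ _ hn, smashCounit, h]
  simp only [LinearMap.comp_apply, smashComul_el]
  rw [h, Coalgebra.lTensor_counit_comul]
  simp

theorem comul_act (B : YDHopfAlgebra k Γ R) (g : Γ) (r : R) :
    comul (R := k) (B.act g r) = TensorProduct.map (B.act g) (B.act g) (comul r) :=
  B.comul_isHom.map_act g r

theorem smashComul_mul (B : YDHopfAlgebra k Γ R) :
    B.smashComul ∘ₗ B.smashMul = TensorProduct.map B.smashMul B.smashMul ∘ₗ
      (TensorProduct.tensorTensorTensorComm k _ _ _ _).toLinearMap ∘ₗ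
      TensorProduct.map B.smashComul B.smashComul := by
  refine B.ext_el₂ (M := (R ⊗[k] MonoidAlgebra k Γ) ⊗[k] (R ⊗[k] MonoidAlgebra k Γ)) fun r g s h => ?_
  have key := LinearMap.congr_fun B.comul_mul (r ⊗ₜ B.act g s)
  simp only [LinearMap.comp_apply, LinearMap.mul'_apply, TensorProduct.map_tmul,
    comul_act] at key
  simp only [LinearMap.comp_apply, smashMul_el, smashComul_el, TensorProduct.map_tmul, key, LinearEquiv.coe_coe]
  generalize comul (R := k) r = x
  generalize comul (R := k) s = y
  induction x using YDModule.homog_induction₂ B.toYDModule B.toYDModule with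
  | zero => simp
  | add x x' hx hy => simp only [map_add, add_tmul, hx, hy]
  | smul a x hx => simp only [map_smul, ← smul_tmul', hx]
  | tmul d m e n hm hn =>
    induction y using YDModule.homog_induction₂ B.toYDModule B.toYDModule with
    | zero => simp
    | add x x' hx hy => simp only [map_add, tmul_add, hx, hy]
    | smul a x hx => simp only [map_smul, tmul_smul, hx]
    | tmul d' m' e' n' hm' hn' =>
      simp [middleMap, YDModule.braiding_homog _ _ hn, auxB_homog _ _ _ hn, auxB_homog _ _ _ hn',
        auxB_homog _ _ _ (B.mul_homog hn (hn'.act g)), smashMul_el, mul_assoc]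

theorem smashCounit_mul (B : YDHopfAlgebra k Γ R) :
    B.smashCounit ∘ₗ B.smashMul =
      LinearMap.mul' k k ∘ₗ TensorProduct.map B.smashCounit B.smashCounit := by
  refine B.ext_el₂ fun r g s h => ?_
  simp [smashMul_el, smashCounit, B.counit_mul, counit_act]

theorem smashAntipode_homog (B : YDHopfAlgebra k Γ R) {b : Γ} {r : R} (hr : B.IsHomog b r)
    (g : Γ) : B.smashAntipode (B.el r g) =
      B.el (B.act (b * g)⁻¹ (B.antipode r)) (b * g)⁻¹ := by
  simp only [smashAntipode, LinearMap.comp_apply, B.cotwist_homog hr, TensorProduct.map_tmul,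
    MonoidAlgebra.antipode_single, CommSemiring.antipode_eq_id, LinearMap.id_apply, twist_single]

theorem smash_antipode_left (B : YDHopfAlgebra k Γ R) :
    B.smashMul ∘ₗ B.smashAntipode.rTensor _ ∘ₗ B.smashComul =
      LinearMap.toSpanSingleton k _ (B.el 1 1) ∘ₗ B.smashCounit := by
  refine B.ext_homog fun b r g hr => ?_
  let Q : MonoidAlgebra k Γ ⊗[k] (R ⊗[k] R) →ₗ[k] R ⊗[k] MonoidAlgebra k Γ :=
    B.smashMul ∘ₗ (TensorProduct.mk k (R ⊗[k] MonoidAlgebra k Γ) (R ⊗[k] MonoidAlgebra k Γ)).flip (B.el 1 g) ∘ₗ B.twist ∘ₗ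
      TensorProduct.map (HopfAlgebra.antipode k (A := MonoidAlgebra k Γ) ∘ₗ
        LinearMap.mulRight k (MonoidAlgebra.single g 1))
        (LinearMap.mul' k R ∘ₗ B.antipode.rTensor R)
  have h : ∀ x, B.smashMul (B.smashAntipode.rTensor _ (B.auxB g x)) =
      Q (YDModule.tensorCoact B.toYDModule B.toYDModule x) := by
    intro x
    induction x using YDModule.homog_induction₂ B.toYDModule B.toYDModule with
    | zero => simp
    | add x y hx hy => simp only [map_add, hx, hy]
    | smul a x hx => simp only [map_smul, hx]
    | tmul d m e n hm hn =>
      rw [YDModule.tensorCoact_homog _ _ hm hn, auxB_homog _ _ _ hn]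
      simp [Q, smashAntipode_homog B hm, smashMul_el, twist_single, act_mul, act_one, mul_assoc]
  have h2 : YDModule.tensorCoact B.toYDModule B.toYDModule (comul r) =
    MonoidAlgebra.single b 1 ⊗ₜ comul r := B.comul_homog hr
  have h3 := LinearMap.congr_fun B.mul_antipode_rTensor_comul r
  simp only [LinearMap.comp_apply] at h3
  simp only [LinearMap.comp_apply, smashComul_el, h, h2]
  rcases B.counit_homog hr with h0 | rfl
  · simp [Q, h3, h0, smashCounit]
  · simp [Q, h3, smashCounit, twist_single, smashMul_el, act_one, Algebra.algebraMap_eq_smul_one]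

theorem smash_antipode_right (B : YDHopfAlgebra k Γ R) :
    B.smashMul ∘ₗ B.smashAntipode.lTensor _ ∘ₗ B.smashComul =
      LinearMap.toSpanSingleton k _ (B.el 1 1) ∘ₗ B.smashCounit := by
  refine B.ext_el fun r g => ?_
  have h : ∀ x, B.smashMul (B.smashAntipode.lTensor _ (B.auxB g x)) =
      B.el (LinearMap.mul' k R (B.antipode.lTensor R x)) 1 := by
    intro x
    induction x using YDModule.homog_induction₂ B.toYDModule B.toYDModule with
    | zero => simp
    | add x y hx hy => simp only [map_add, hx, hy, add_tmul]
    | smul a x hx => simp only [map_smul, hx, smul_tmul']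
    | tmul d m e n hm hn =>
      rw [auxB_homog _ _ _ hn]
      have h4 : B.act (e * g) (B.act (e * g)⁻¹ (B.antipode n)) = B.antipode n := by
        rw [← Module.End.mul_apply, ← map_mul, mul_inv_cancel, map_one, Module.End.one_apply]
      rw [LinearMap.lTensor_tmul, smashAntipode_homog B hn, smashMul_el, h4]
      simp
  have h3 := LinearMap.congr_fun B.mul_antipode_lTensor_comul r
  simp only [LinearMap.comp_apply] at h3
  simp only [LinearMap.comp_apply, smashComul_el, h, h3]
  simp [smashCounit, Algebra.algebraMap_eq_smul_one, ← smul_tmul']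

/-! ### The bosonization as a Hopf algebra -/

/-- The bosonization `R # kΓ`, with underlying vector space `R ⊗ kΓ`. -/
def Bosonization (_ : YDHopfAlgebra k Γ R) : Type _ := R ⊗[k] MonoidAlgebra k Γ

variable (B : YDHopfAlgebra k Γ R)

/-- The element `r # x` of the bosonization. -/
def smash (r : R) (x : MonoidAlgebra k Γ) : B.Bosonization := r ⊗ₜ[k] x

instance : AddCommGroup B.Bosonization :=
  inferInstanceAs (AddCommGroup (R ⊗[k] MonoidAlgebra k Γ))

instance : Module k B.Bosonization :=
  inferInstanceAs (Module k (R ⊗[k] MonoidAlgebra k Γ))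

instance : Ring B.Bosonization where
  __ := (inferInstance : AddCommGroup B.Bosonization)
  mul a b := B.smashMul (TensorProduct.tmul k (M := R ⊗[k] MonoidAlgebra k Γ)
    (N := R ⊗[k] MonoidAlgebra k Γ) a b)
  one := B.el 1 1
  mul_assoc := B.smashMul_assoc
  one_mul := B.one_smashMul
  mul_one := B.smashMul_one
  left_distrib a b c := (congrArg B.smashMul (tmul_add _ _ _)).trans (map_add _ _ _)
  right_distrib a b c := (congrArg B.smashMul (add_tmul _ _ _)).trans (map_add _ _ _)
  zero_mul a := (congrArg B.smashMul (zero_tmul _ _)).trans (map_zero _)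
  mul_zero a := (congrArg B.smashMul (tmul_zero _ _)).trans (map_zero _)

instance : Algebra k B.Bosonization :=
  Algebra.ofModule B.smul_smashMul B.smashMul_smul

instance : Coalgebra k B.Bosonization where
  comul := B.smashComul
  counit := B.smashCounit
  coassoc := B.smashComul_coassoc
  rTensor_counit_comp_comul := B.smash_counit_comul
  lTensor_counit_comp_comul := B.smash_comul_counit

theorem bosonization_comul_mul (a b : B.Bosonization) :
    comul (R := k) (a * b) = comul (R := k) a * comul (R := k) b := by
  have h := LinearMap.congr_fun (LinearMap.mul'_tensor (R := k) (A := B.Bosonization)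
    (B := B.Bosonization)) (comul (R := k) a ⊗ₜ comul (R := k) b)
  rw [LinearMap.mul'_apply] at h
  rw [h]
  have h2 : LinearMap.mul' k B.Bosonization = B.smashMul := TensorProduct.ext' fun _ _ => rfl
  rw [h2]
  exact LinearMap.congr_fun B.smashComul_mul (TensorProduct.tmul k
    (M := R ⊗[k] MonoidAlgebra k Γ) (N := R ⊗[k] MonoidAlgebra k Γ) a b)

instance : Bialgebra k B.Bosonization :=
  Bialgebra.mk' k B.Bosonization
    (by
      change B.smashCounit (B.el 1 1) = 1
      simp [smashCounit, B.counit_one])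
    (fun {a b} => LinearMap.congr_fun B.smashCounit_mul (TensorProduct.tmul k
      (M := R ⊗[k] MonoidAlgebra k Γ) (N := R ⊗[k] MonoidAlgebra k Γ) a b))
    (by
      change B.smashComul (B.el 1 1) = B.el 1 1 ⊗ₜ B.el 1 1
      rw [smashComul_el, B.comul_one, auxB_homog _ _ _ B.coact_one, mul_one])
    (B.bosonization_comul_mul _ _)

instance : HopfAlgebra k B.Bosonization where
  antipode := B.smashAntipode
  mul_antipode_rTensor_comul := by
    have h2 : LinearMap.mul' k B.Bosonization = B.smashMul := TensorProduct.ext' fun _ _ => rfl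
    have h3 : Algebra.linearMap k B.Bosonization =
        LinearMap.toSpanSingleton k _ (B.el 1 1) := LinearMap.ext fun _ => rfl
    rw [h2, h3]
    exact B.smash_antipode_left
  mul_antipode_lTensor_comul := by
    have h2 : LinearMap.mul' k B.Bosonization = B.smashMul := TensorProduct.ext' fun _ _ => rfl
    have h3 : Algebra.linearMap k B.Bosonization =
        LinearMap.toSpanSingleton k _ (B.el 1 1) := LinearMap.ext fun _ => rfl
    rw [h2, h3]
    exact B.smash_antipode_right

end YDHopfAlgebra

/-! ### Coradical, primitive elements, ET-algebras -/

section Coradical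

variable (k : Type u) {C : Type w} [Field k] [AddCommGroup C] [Module k C] [Coalgebra k C]

/-- `D` is a subcoalgebra: `Δ(D) ⊆ D ⊗ D`. -/
def IsSubcoalgebra (D : Submodule k C) : Prop :=
  D.map (comul (R := k) (A := C)) ≤ LinearMap.range (TensorProduct.map D.subtype D.subtype)

/-- `D` is a simple subcoalgebra: nonzero, with no subcoalgebras but `0` and itself. -/
def IsSimpleSubcoalgebra (D : Submodule k C) : Prop :=
  IsSubcoalgebra k D ∧ D ≠ ⊥ ∧ ∀ E ≤ D, IsSubcoalgebra k E → E = ⊥ ∨ E = D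

variable (C) in
/-- The coradical: the sum of all simple subcoalgebras. -/
def coradical : Submodule k C :=
  sSup {D | IsSimpleSubcoalgebra k D}

end Coradical

/-- The space of primitive elements `{x | Δ(x) = 1 ⊗ x + x ⊗ 1}`. -/
def primitives (k : Type u) (R : Type w) [Field k] [Ring R] [Algebra k R] [Coalgebra k R] :
    Submodule k R :=
  LinearMap.ker (comul (R := k) (A := R) -
    (TensorProduct.mk k R R 1 + (TensorProduct.mk k R R).flip 1))

/-! ### Extensions of Hopf algebras -/

/-- Exactness of a sequence `k → A --ι--> C --π--> B → k` of Hopf algebras: `ι` is injective, `π`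
is surjective, `ker π = C ι(A)⁺ = ι(A)⁺ C`, and `ι(A)` is the algebra of both right and left
`π`-coinvariants of `C`. -/
structure IsHopfExact (k : Type u) [Field k] {A B C : Type*} [Ring A] [HopfAlgebra k A]
    [Ring B] [HopfAlgebra k B] [Ring C] [HopfAlgebra k C]
    (ι : A →ₐc[k] C) (π : C →ₐc[k] B) : Prop where
  injective : Function.Injective ι
  surjective : Function.Surjective π
  ker_eq_left : ∀ c : C, π c = 0 ↔
    c ∈ Submodule.span k {x : C | ∃ (c' : C) (a : A), counit (R := k) a = 0 ∧ x = c' * ι a}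
  ker_eq_right : ∀ c : C, π c = 0 ↔
    c ∈ Submodule.span k {x : C | ∃ (c' : C) (a : A), counit (R := k) a = 0 ∧ x = ι a * c'}
  coinv_right : ∀ c : C, c ∈ Set.range ι ↔
    (π : C →ₗ[k] B).lTensor C (comul (R := k) c) = c ⊗ₜ 1
  coinv_left : ∀ c : C, c ∈ Set.range ι ↔
    (π : C →ₗ[k] B).rTensor C (comul (R := k) c) = 1 ⊗ₜ c

namespace YDHopfAlgebra

variable {k : Type u} {Γ : Type v} {R : Type w} [Field k] [Group Γ]
  [Ring R] [Algebra k R] [Coalgebra k R]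

/-- `R` is an ET-algebra: its coradical is `k 1`, and the primitive elements generate it as an
algebra. -/
def IsET (_ : YDHopfAlgebra k Γ R) : Prop :=
  coradical k R = Submodule.span k {(1 : R)} ∧
    Algebra.adjoin k (primitives k R : Set R) = ⊤

/-- `B₁` is the Hopf algebra `R`, with the same algebra and coalgebra structure, regarded in the
Yetter-Drinfeld category over `kΓ₁` for a subgroup `Γ₁` of `Γ`: the action is restricted to `Γ₁`,
and the coaction of `kΓ` is the one of `kΓ₁` followed by the inclusion `kΓ₁ ⊆ kΓ`. -/
def IsRestriction (B : YDHopfAlgebra k Γ R) {Γ₁ : Subgroup Γ} (B₁ : YDHopfAlgebra k Γ₁ R) : Prop :=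
  (∀ g : Γ₁, B₁.act g = B.act (g : Γ)) ∧
    B.coact = (MonoidAlgebra.mapDomainAlgHom k k Γ₁.subtype).toLinearMap.rTensor R ∘ₗ B₁.coact

/-- `R` can be obtained from the abelian case: there are an abelian subgroup `Γ₁` of `Γ` over which
`R` is a Yetter-Drinfeld Hopf algebra, a group `Γ₂`, and an exact sequence of Hopf algebras
`k → R # kΓ₁ → R # kΓ → kΓ₂ → k` whose first map is the inclusion `r # h ↦ r # h`. -/
def ObtainedFromAbelianCase (B : YDHopfAlgebra k Γ R) : Prop :=
  ∃ (Γ₁ : Subgroup Γ) (B₁ : YDHopfAlgebra k Γ₁ R) (Γ₂ : Type v) (_ : Group Γ₂)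
    (ι : B₁.Bosonization →ₐc[k] B.Bosonization)
    (π : B.Bosonization →ₐc[k] MonoidAlgebra k Γ₂),
    IsMulCommutative Γ₁ ∧
    B.IsRestriction B₁ ∧
    (∀ (r : R) (x : MonoidAlgebra k Γ₁),
      ι (B₁.smash r x) = B.smash r (MonoidAlgebra.mapDomainAlgHom k k Γ₁.subtype x)) ∧
    IsHopfExact k ι π

end YDHopfAlgebra
end

/-! A Yetter–Drinfeld module over `kΓ` is a `Γ`-graded space on which `x` carries degree `g` to
degree `x * g * x⁻¹`. The primitives of `R` form a graded, `Γ`-stable subspace, so the set `D` of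
degrees of nonzero homogeneous primitives is closed under conjugation. If `g` and `h` in `D` did not
commute, then `g`, `h` and `g * h * g⁻¹` would be three distinct elements of `D`, and primitives of
these degrees would be linearly independent in a space of dimension 2. Hence `D` generates an
abelian normal subgroup `Γ₁` (`commute_of_mem_primitiveDegrees`, `normal_closure_primitiveDegrees`).

Degrees multiply and the primitives generate `R`, so all of `R` is graded by `Γ₁`
(`span_homog_closure_primitiveDegrees`). The coaction therefore takes values in `kΓ₁ ⊗ R`, and every
structure map of `R` remains a morphism over `Γ₁` (`restrict`).

For `Γ₂ = Γ ⧸ Γ₁` the projection is `r # g ↦ ε(r) [g]`. Exactness (`IsRestriction.isHopfExact`) is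
computed on the elements `r # g`: the kernel is spanned by the `r # g` with `ε(r) = 0` and the `1 #
g - 1 # h` with `g`, `h` in one coset, and both coactions of `kΓ₂` on `r # g` are given by the coset
of `g` alone. -/

namespace YDModule

/-! ### The grading underlying a Yetter–Drinfeld module -/

section Components

variable {k : Type u} {Γ : Type v} [Field k] [Group Γ]
variable {V : Type w} [AddCommGroup V] [Module k V] {W : Type w'} [AddCommGroup W] [Module k W]

/-- The linear map on `kΓ` with prescribed values on the group elements. -/
noncomputable def linearExtension {Γ : Type v} {M : Type*} [AddCommGroup M] [Module k M] (f : Γ → M) :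
    MonoidAlgebra k Γ →ₗ[k] M :=
  Finsupp.linearCombination k f ∘ₗ (MonoidAlgebra.coeffLinearEquiv k).toLinearMap

@[simp]
theorem linearExtension_single {Γ : Type v} {M : Type*} [AddCommGroup M] [Module k M] (f : Γ → M) (g : Γ)
    (a : k) : linearExtension f (MonoidAlgebra.single g a) = a • f g := by
  simp [linearExtension]

open Classical in
/-- The projection of a Yetter-Drinfeld module to its homogeneous component of degree `g`. -/
noncomputable def component (X : YDModule k Γ V) (g : Γ) : V →ₗ[k] V :=
  (TensorProduct.lid k V).toLinearMap ∘ₗ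
    (linearExtension fun h : Γ => if h = g then (1 : k) else 0).rTensor V ∘ₗ X.coact

theorem IsHomog.component_self {X : YDModule k Γ V} {g : Γ} {m : V} (h : X.IsHomog g m) :
    X.component g m = m := by
  unfold IsHomog at h
  simp [component, h]

theorem IsHomog.component_of_ne {X : YDModule k Γ V} {g g' : Γ} {m : V} (h : X.IsHomog g m)
    (hg : g ≠ g') : X.component g' m = 0 := by
  unfold IsHomog at h
  simp [component, h, hg]

theorem isHomog_component (X : YDModule k Γ V) (g : Γ) (m : V) :
    X.IsHomog g (X.component g m) := by
  refine LinearMap.congr_fun (f := X.coact ∘ₗ X.component g)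
    (g := TensorProduct.mk k _ _ (MonoidAlgebra.single g 1) ∘ₗ X.component g)
    (X.hom_ext fun g' m hm => ?_) m
  by_cases h : g' = g
  · subst h
    simpa [hm.component_self] using (show X.coact m = _ from hm)
  · simp [hm.component_of_ne h]

theorem sum_component [Fintype Γ] (X : YDModule k Γ V) (m : V) :
    ∑ g, X.component g m = m := by
  refine LinearMap.congr_fun (f := ∑ g, X.component g) (g := LinearMap.id)
    (X.hom_ext fun g m hm => ?_) m |> fun h => by simpa using h
  rw [LinearMap.sum_apply, Finset.sum_eq_single g]
  · exact hm.component_self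
  · exact fun g' _ h => hm.component_of_ne h.symm
  · simp

theorem act_injective (X : YDModule k Γ V) (g : Γ) : Function.Injective (X.act g) := by
  refine Function.LeftInverse.injective (g := X.act g⁻¹) fun m => ?_
  rw [← Module.End.mul_apply, ← map_mul, inv_mul_cancel, map_one, Module.End.one_apply]

/-- Nonzero homogeneous elements of pairwise different degrees are linearly independent. -/
theorem linearIndependent_of_isHomog (X : YDModule k Γ V) {ι : Type*} {d : ι → Γ} {v : ι → V}
    (hd : Function.Injective d) (hv : ∀ i, X.IsHomog (d i) (v i)) (h0 : ∀ i, v i ≠ 0) :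
    LinearIndependent k v := by
  rw [linearIndependent_iff']
  intro s c hs i hi
  -- Projecting the relation to degree `d i` annihilates every term but the `i`-th.
  have h := congrArg (X.component (d i)) hs
  rw [map_sum, Finset.sum_eq_single i, map_smul, (hv i).component_self, map_zero] at h
  · exact (smul_eq_zero.1 h).resolve_right (h0 i)
  · intro j _ hj
    rw [map_smul, (hv j).component_of_ne (hd.ne hj), smul_zero]
  · exact fun h => (h hi).elim

end Components

/-! ### Restriction of Yetter–Drinfeld modules to a subgroup containing all degrees -/

section Restriction

variable {k : Type u} {Γ : Type v} [Field k] [Group Γ] {Γ₁ : Subgroup Γ}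
variable {V : Type w} [AddCommGroup V] [Module k V] {W : Type w'} [AddCommGroup W] [Module k W]

/-- The inclusion `kΓ₁ ⊆ kΓ`. -/
noncomputable abbrev incl (k : Type u) [Field k] (Γ₁ : Subgroup Γ) :
    MonoidAlgebra k Γ₁ →ₗ[k] MonoidAlgebra k Γ :=
  (MonoidAlgebra.mapDomainAlgHom k k Γ₁.subtype).toLinearMap

theorem incl_single (g : Γ₁) (a : k) :
    incl k Γ₁ (MonoidAlgebra.single g a) = MonoidAlgebra.single (g : Γ) a := by
  simp [incl]

open Classical in
/-- The projection `kΓ → kΓ₁` which annihilates the group elements outside `Γ₁`. -/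
noncomputable def proj (k : Type u) [Field k] (Γ₁ : Subgroup Γ) :
    MonoidAlgebra k Γ →ₗ[k] MonoidAlgebra k Γ₁ :=
  linearExtension fun g => if h : g ∈ Γ₁ then MonoidAlgebra.single ⟨g, h⟩ 1 else 0

theorem proj_single_mem {g : Γ} (h : g ∈ Γ₁) :
    proj k Γ₁ (MonoidAlgebra.single g 1) = MonoidAlgebra.single ⟨g, h⟩ 1 := by
  simp [proj, h]

theorem proj_single_notMem {g : Γ} (h : g ∉ Γ₁) :
    proj k Γ₁ (MonoidAlgebra.single g 1) = 0 := by
  simp [proj, h]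

theorem proj_comp_incl : proj k Γ₁ ∘ₗ incl k Γ₁ = LinearMap.id := by
  ext g
  simp [proj]

/-- `proj` is a retraction of the inclusion. Consequently identities of `kΓ₁`-coactions can be
verified over `kΓ`. -/
theorem incl_rTensor_injective : Function.Injective ((incl k Γ₁).rTensor V) := by
  refine Function.LeftInverse.injective (g := (proj k Γ₁).rTensor V) fun t => ?_
  rw [← LinearMap.comp_apply, ← LinearMap.rTensor_comp, proj_comp_incl, LinearMap.rTensor_id,
    LinearMap.id_apply]

/-- `X₁` is the Yetter-Drinfeld module `X` regarded over the subgroup `Γ₁`. -/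
structure IsRestriction (X : YDModule k Γ V) (X₁ : YDModule k Γ₁ V) : Prop where
  act_eq : ∀ g : Γ₁, X₁.act g = X.act (g : Γ)
  coact_eq : X.coact = (incl k Γ₁).rTensor V ∘ₗ X₁.coact

theorem IsRestriction.isHomog {X : YDModule k Γ V} {X₁ : YDModule k Γ₁ V}
    (h : X.IsRestriction X₁) {g : Γ₁} {m : V} (hm : X₁.IsHomog g m) : X.IsHomog (g : Γ) m := by
  unfold IsHomog at *
  rw [h.coact_eq, LinearMap.comp_apply, hm, LinearMap.rTensor_tmul, incl_single]

/-- It suffices to compare the coactions on elements homogeneous over `Γ₁`: these span, and they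
keep their degree over `Γ`. -/
theorem IsRestriction.tensor {X : YDModule k Γ V} {X₁ : YDModule k Γ₁ V} {Y : YDModule k Γ W}
    {Y₁ : YDModule k Γ₁ W} (hX : X.IsRestriction X₁) (hY : Y.IsRestriction Y₁) :
    (X.tensor Y).IsRestriction (X₁.tensor Y₁) where
  act_eq g := by
    simp [YDModule.tensor, Representation.tprod, hX.act_eq, hY.act_eq]
  coact_eq := by
    refine hom_ext₂ X₁ Y₁ fun g m g' n hm hn => ?_
    simp only [YDModule.tensor, LinearMap.comp_apply, tensorCoact_homog _ _ hm hn,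
      tensorCoact_homog _ _ (hX.isHomog hm) (hY.isHomog hn), LinearMap.rTensor_tmul, incl_single,
      Subgroup.coe_mul]

theorem isRestriction_unit : (unit k Γ).IsRestriction (unit k Γ₁) where
  act_eq g := by ext; simp [unit]
  coact_eq := by ext; simp [unit, MonoidAlgebra.one_def]

theorem IsRestriction.isHom {X : YDModule k Γ V} {X₁ : YDModule k Γ₁ V} {Y : YDModule k Γ W}
    {Y₁ : YDModule k Γ₁ W} (hX : X.IsRestriction X₁) (hY : Y.IsRestriction Y₁) {f : V →ₗ[k] W}
    (hf : X.IsHom Y f) : X₁.IsHom Y₁ f where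
  map_act g m := by rw [hX.act_eq, hY.act_eq, hf.map_act]
  map_coact := by
    refine LinearMap.ext fun m => incl_rTensor_injective ?_
    have h := LinearMap.congr_fun hf.map_coact m
    rw [hX.coact_eq, hY.coact_eq] at h
    simp only [LinearMap.comp_apply] at h ⊢
    rw [h, ← LinearMap.comp_apply, ← LinearMap.comp_apply (LinearMap.rTensor _ _),
      LinearMap.lTensor_comp_rTensor, LinearMap.rTensor_comp_lTensor]

/-- On a homogeneous first factor the braiding involves only the action of its degree, which is the
same over both groups. This transports the braided compatibility of product and coproduct unchanged.
-/
theorem IsRestriction.braiding {X : YDModule k Γ V} {X₁ : YDModule k Γ₁ V} {Y : YDModule k Γ W}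
    {Y₁ : YDModule k Γ₁ W} (hX : X.IsRestriction X₁) (hY : Y.IsRestriction Y₁) :
    X₁.braiding Y₁ = X.braiding Y := by
  refine hom_ext₂ X₁ Y₁ fun g m g' n hm hn => ?_
  rw [braiding_homog _ _ hm, braiding_homog _ _ (hX.isHomog hm), hY.act_eq]

/-- The restriction of a Yetter-Drinfeld module spanned by homogeneous elements with degree in the
subgroup `Γ₁`. -/
noncomputable def restrict (X : YDModule k Γ V)
    (h : Submodule.span k {m | ∃ g ∈ Γ₁, X.IsHomog g m} = ⊤) : YDModule k Γ₁ V :=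
  -- The candidate coaction discards the part of `kΓ` outside `Γ₁`. By `h` all axioms need checking
  -- only on elements with degree in `Γ₁`, where nothing is discarded.
  have key : ∀ m, ∀ g : Γ₁, X.IsHomog g m →
      (proj k Γ₁).rTensor V (X.coact m) = MonoidAlgebra.single g 1 ⊗ₜ m := fun m g hm => by
    unfold IsHomog at hm
    rw [hm, LinearMap.rTensor_tmul, proj_single_mem g.2]
  { act := X.act.comp Γ₁.subtype
    coact := (proj k Γ₁).rTensor V ∘ₗ X.coact
    coact_coassoc := by
      refine LinearMap.ext_on h fun m ⟨g, hg, hm⟩ => ?_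
      simp [key m ⟨g, hg⟩ hm]
    coact_counit := by
      refine LinearMap.ext_on h fun m ⟨g, hg, hm⟩ => ?_
      simp [key m ⟨g, hg⟩ hm]
    coact_act := fun x m => by
      refine LinearMap.congr_fun (f := ((proj k Γ₁).rTensor V ∘ₗ X.coact) ∘ₗ X.act (x : Γ))
        (g := TensorProduct.map (LinearMap.mulLeft k (MonoidAlgebra.single x (1 : k)) ∘ₗ
          LinearMap.mulRight k (MonoidAlgebra.single x⁻¹ (1 : k))) (X.act (x : Γ)) ∘ₗ
            (proj k Γ₁).rTensor V ∘ₗ X.coact) ?_ m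
      refine LinearMap.ext_on h fun m ⟨g, hg, hm⟩ => ?_
      -- Conjugation by `x ∈ Γ₁` keeps the degree inside `Γ₁`.
      have hx := key _ (x * ⟨g, hg⟩ * x⁻¹) (hm.act (x : Γ))
      simp [key m ⟨g, hg⟩ hm, hx, mul_assoc] }

theorem isRestriction_restrict (X : YDModule k Γ V)
    (h : Submodule.span k {m | ∃ g ∈ Γ₁, X.IsHomog g m} = ⊤) :
    X.IsRestriction (X.restrict h) where
  act_eq _ := rfl
  coact_eq := by
    refine LinearMap.ext_on h fun m ⟨g, hg, hm⟩ => ?_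
    unfold IsHomog at hm
    simp [restrict, hm, proj_single_mem hg]

end Restriction

end YDModule

/-! ### Restriction of Hopf algebras, and the degrees of primitive elements -/

namespace YDHopfAlgebra

variable {k : Type u} {Γ : Type v} {R : Type w} [Field k] [Group Γ]
  [Ring R] [Algebra k R] [Coalgebra k R]

/-- The restriction of a Yetter-Drinfeld Hopf algebra spanned by homogeneous elements with degree
in the subgroup `Γ₁`. -/
noncomputable def restrict (B : YDHopfAlgebra k Γ R) {Γ₁ : Subgroup Γ}
    (h : Submodule.span k {m | ∃ g ∈ Γ₁, B.IsHomog g m} = ⊤) : YDHopfAlgebra k Γ₁ R :=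
  have hB := B.isRestriction_restrict h
  { toYDModule := B.toYDModule.restrict h
    mul_isHom := (hB.tensor hB).isHom hB B.mul_isHom
    one_isHom := YDModule.isRestriction_unit.isHom hB B.one_isHom
    comul_isHom := hB.isHom (hB.tensor hB) B.comul_isHom
    counit_isHom := hB.isHom YDModule.isRestriction_unit B.counit_isHom
    counit_one := B.counit_one
    counit_mul := B.counit_mul
    comul_one := B.comul_one
    comul_mul := by rw [hB.braiding hB, B.comul_mul]
    antipode := B.antipode
    antipode_isHom := hB.isHom hB B.antipode_isHom
    mul_antipode_rTensor_comul := B.mul_antipode_rTensor_comul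
    mul_antipode_lTensor_comul := B.mul_antipode_lTensor_comul }

theorem isRestriction_restrict (B : YDHopfAlgebra k Γ R) {Γ₁ : Subgroup Γ}
    (h : Submodule.span k {m | ∃ g ∈ Γ₁, B.IsHomog g m} = ⊤) :
    B.IsRestriction (B.restrict h) :=
  have hB := B.toYDModule.isRestriction_restrict h
  ⟨hB.act_eq, hB.coact_eq⟩

/-! ### Homogeneous primitive elements -/

theorem mem_primitives {x : R} :
    x ∈ primitives k R ↔ comul (R := k) x = 1 ⊗ₜ x + x ⊗ₜ 1 := by
  simp [primitives, sub_eq_zero]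

theorem act_mem_primitives (B : YDHopfAlgebra k Γ R) (g : Γ) {x : R} (hx : x ∈ primitives k R) :
    B.act g x ∈ primitives k R := by
  rw [mem_primitives] at *
  simp [B.comul_act, hx, B.act_one]

/-- Since `1` has degree `1` and the comultiplication is colinear, `x ↦ Δ(x) - 1 ⊗ x - x ⊗ 1`
preserves degrees. It thus commutes with the projections to components, and its kernel is a graded
subspace. -/
theorem component_mem_primitives (B : YDHopfAlgebra k Γ R) (g : Γ) {x : R}
    (hx : x ∈ primitives k R) : B.component g x ∈ primitives k R := by
  set f : R →ₗ[k] R ⊗[k] R := comul (R := k) (A := R) -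
    (TensorProduct.mk k R R 1 + (TensorProduct.mk k R R).flip 1)
  have h : f ∘ₗ B.component g = (B.tensor B.toYDModule).component g ∘ₗ f := by
    refine B.hom_ext fun g' m hm => ?_
    have hc := B.comul_homog hm
    have h1 := B.tensor_homog B.coact_one hm
    have h2 := B.tensor_homog hm B.coact_one
    rw [one_mul] at h1
    rw [mul_one] at h2
    by_cases hg : g' = g
    · subst hg
      simp [f, hm.component_self, hc.component_self, h1.component_self, h2.component_self]
    · simp [f, hm.component_of_ne hg, hc.component_of_ne hg, h1.component_of_ne hg,
        h2.component_of_ne hg]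
  have h' := LinearMap.congr_fun h x
  have hx' : f x = 0 := hx
  rw [LinearMap.comp_apply, LinearMap.comp_apply, hx', map_zero] at h'
  exact h'

/-- The degrees of the nonzero homogeneous primitive elements. -/
def primitiveDegrees (B : YDHopfAlgebra k Γ R) : Set Γ :=
  {g | ∃ x ∈ primitives k R, x ≠ 0 ∧ B.IsHomog g x}

theorem conj_mem_primitiveDegrees (B : YDHopfAlgebra k Γ R) {g : Γ} (hg : g ∈ B.primitiveDegrees)
    (x : Γ) : x * g * x⁻¹ ∈ B.primitiveDegrees := by
  obtain ⟨m, hm, h0, hgm⟩ := hg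
  refine ⟨B.act x m, B.act_mem_primitives x hm, ?_, hgm.act x⟩
  exact fun h => h0 (B.act_injective x (h.trans (map_zero _).symm))

instance normal_closure_primitiveDegrees (B : YDHopfAlgebra k Γ R) :
    (Subgroup.closure B.primitiveDegrees).Normal := by
  refine ⟨fun n hn g => ?_⟩
  induction hn using Subgroup.closure_induction with
  | mem x hx => exact Subgroup.subset_closure (B.conj_mem_primitiveDegrees hx g)
  | one => simp
  | mul x y _ _ hx hy => simpa [mul_assoc] using mul_mem hx hy
  | inv x _ hx => simpa [mul_assoc] using inv_mem hx

/-- This is where dimension 2 enters: a noncommuting pair and one conjugate give three different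
degrees, one too many. -/
theorem commute_of_mem_primitiveDegrees (B : YDHopfAlgebra k Γ R)
    (hdim : Module.finrank k (primitives k R) = 2) {g h : Γ} (hg : g ∈ B.primitiveDegrees)
    (hh : h ∈ B.primitiveDegrees) : g * h = h * g := by
  by_contra hne
  have hc := B.conj_mem_primitiveDegrees hh g
  have h1 : g ≠ h := fun h => hne (by rw [h])
  have h2 : g ≠ g * h * g⁻¹ := fun e => h1 (by
    have := congrArg (fun z => g⁻¹ * z * g) e
    simpa [mul_assoc] using this)
  have h3 : h ≠ g * h * g⁻¹ := fun e => hne (mul_inv_eq_iff_eq_mul.1 e.symm)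
  obtain ⟨x, hx, hx0, hgx⟩ := hg
  obtain ⟨y, hy, hy0, hhy⟩ := hh
  obtain ⟨z, hz, hz0, hcz⟩ := hc
  -- Independence is tested in `R`, where homogeneous elements of distinct degrees are independent.
  have hli : LinearIndependent k
      ![(⟨x, hx⟩ : primitives k R), ⟨y, hy⟩, ⟨z, hz⟩] := by
    refine LinearIndependent.of_comp (primitives k R).subtype ?_
    refine B.linearIndependent_of_isHomog (d := ![g, h, g * h * g⁻¹]) ?_ ?_ ?_
    · intro i j hij
      fin_cases i <;> fin_cases j <;> first | rfl | simp_all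
    · intro i
      fin_cases i <;> assumption
    · intro i
      fin_cases i <;> assumption
  -- `finrank` is 0 on an infinite-dimensional space, so the value 2 forces finite dimension and the
  -- cardinality bound applies.
  have : Module.Finite k (primitives k R) := Module.finite_of_finrank_pos (by omega)
  have := hli.fintype_card_le_finrank
  simp [hdim] at this

/-- The span of the elements with degree in a subgroup is a subalgebra, so it suffices that it
contain the primitives. -/
theorem span_homog_closure_primitiveDegrees [Finite Γ] (B : YDHopfAlgebra k Γ R)
    (hgen : Algebra.adjoin k (primitives k R : Set R) = ⊤) :
    Submodule.span k {m | ∃ g ∈ Subgroup.closure B.primitiveDegrees, B.IsHomog g m} = ⊤ := by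
  have := Fintype.ofFinite Γ
  set N := Submodule.span k {m | ∃ g ∈ Subgroup.closure B.primitiveDegrees, B.IsHomog g m}
  have hone : (1 : R) ∈ N := Submodule.subset_span ⟨1, one_mem _, B.coact_one⟩
  have hmul : N * N ≤ N := by
    rw [Submodule.span_mul_span, Submodule.span_le]
    rintro _ ⟨a, ⟨g, hg, ha⟩, b, ⟨h, hh, hb⟩, rfl⟩
    exact Submodule.subset_span ⟨g * h, mul_mem hg hh, B.mul_homog ha hb⟩
  rw [eq_top_iff]
  intro x _
  have hx : x ∈ Algebra.adjoin k (primitives k R : Set R) := by rw [hgen]; trivial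
  induction hx using Algebra.adjoin_induction with
  | mem x hx =>
    -- Each nonzero component of a primitive is itself primitive, so its degree is one of the
    -- generators of the subgroup.
    rw [← B.sum_component x]
    refine Submodule.sum_mem _ fun g _ => ?_
    by_cases h0 : B.component g x = 0
    · rw [h0]
      exact zero_mem _
    · exact Submodule.subset_span ⟨g, Subgroup.subset_closure
        ⟨_, B.component_mem_primitives g hx, h0, B.isHomog_component g x⟩, B.isHomog_component g x⟩
  | algebraMap r =>
    rw [Algebra.algebraMap_eq_smul_one]
    exact Submodule.smul_mem _ _ hone
  | add x y _ _ hx hy => exact add_mem (hx trivial) (hy trivial)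
  | mul x y _ _ hx hy => exact hmul (Submodule.mul_mem_mul (hx trivial) (hy trivial))

end YDHopfAlgebra

namespace YDHopfAlgebra

/-! ### The exact sequence of bosonizations -/

section Extension

variable {k : Type u} {Γ : Type v} {R : Type w} [Field k] [Group Γ]
  [Ring R] [Algebra k R] [Coalgebra k R] {B : YDHopfAlgebra k Γ R} {Γ₁ : Subgroup Γ}
  {B₁ : YDHopfAlgebra k Γ₁ R}

theorem IsRestriction.toYDModule (hR : B.IsRestriction B₁) :
    B.toYDModule.IsRestriction B₁.toYDModule :=
  ⟨hR.1, hR.2⟩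

/-! ### The inclusion of the bosonizations -/

variable (R) in
/-- The linear map underlying the inclusion of the bosonizations. -/
noncomputable abbrev inclLin (Γ₁ : Subgroup Γ) :
    R ⊗[k] MonoidAlgebra k Γ₁ →ₗ[k] R ⊗[k] MonoidAlgebra k Γ :=
  (YDModule.incl k Γ₁).lTensor R

theorem inclLin_el (B : YDHopfAlgebra k Γ R) (B₁ : YDHopfAlgebra k Γ₁ R) (r : R) (g : Γ₁) :
    inclLin R Γ₁ (B₁.el r g) = B.el r (g : Γ) := by
  rw [inclLin, LinearMap.lTensor_tmul, YDModule.incl_single]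

theorem IsRestriction.map_inclLin_auxB (hR : B.IsRestriction B₁) (g : Γ₁) (t : R ⊗[k] R) :
    TensorProduct.map (inclLin R Γ₁) (inclLin R Γ₁) (B₁.auxB g t) = B.auxB (g : Γ) t := by
  induction t using YDModule.homog_induction₂ B₁.toYDModule B₁.toYDModule with
  | zero => simp
  | add x y hx hy => simp only [map_add, hx, hy]
  | smul a x hx => simp only [map_smul, hx]
  | tmul d m e n hm hn =>
    rw [auxB_homog _ _ _ hn, auxB_homog _ _ _ (hR.toYDModule.isHomog hn), TensorProduct.map_tmul,
      inclLin_el B B₁, inclLin_el B B₁, Subgroup.coe_mul]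

/-- The inclusion `R # kΓ₁ → R # kΓ`. -/
noncomputable def IsRestriction.inclusion (hR : B.IsRestriction B₁) :
    B₁.Bosonization →ₐc[k] B.Bosonization where
  toFun := inclLin R Γ₁
  map_add' := map_add (inclLin (k := k) R Γ₁)
  map_smul' := map_smul (inclLin (k := k) R Γ₁)
  counit_comp := B₁.ext_el fun r g => by
    change B.smashCounit (inclLin R Γ₁ (B₁.el r g)) = B₁.smashCounit (B₁.el r g)
    simp [smashCounit]
  map_comp_comul := B₁.ext_el (M := (R ⊗[k] MonoidAlgebra k Γ) ⊗[k] (R ⊗[k] MonoidAlgebra k Γ))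
    fun r g => by
      change TensorProduct.map (inclLin R Γ₁) (inclLin R Γ₁) (B₁.smashComul (B₁.el r g)) =
        B.smashComul (inclLin R Γ₁ (B₁.el r g))
      rw [inclLin_el B B₁, smashComul_el, smashComul_el, hR.map_inclLin_auxB]
  map_one' := by
    change inclLin R Γ₁ (B₁.el 1 1) = B.el 1 1
    rw [inclLin_el B B₁, Subgroup.coe_one]
  map_mul' x y := by
    refine LinearMap.congr_fun (f := inclLin R Γ₁ ∘ₗ B₁.smashMul)
      (g := B.smashMul ∘ₗ TensorProduct.map (inclLin R Γ₁) (inclLin R Γ₁))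
      (B₁.ext_el₂ fun r g s h => ?_) (TensorProduct.tmul k (M := R ⊗[k] MonoidAlgebra k Γ₁)
      (N := R ⊗[k] MonoidAlgebra k Γ₁) x y)
    rw [LinearMap.comp_apply, LinearMap.comp_apply, TensorProduct.map_tmul, smashMul_el,
      inclLin_el B B₁, inclLin_el B B₁, inclLin_el B B₁, smashMul_el, hR.1, Subgroup.coe_mul]

theorem IsRestriction.inclusion_apply (hR : B.IsRestriction B₁)
    (x : R ⊗[k] MonoidAlgebra k Γ₁) : hR.inclusion x = inclLin R Γ₁ x := rfl

theorem IsRestriction.inclusion_smash (hR : B.IsRestriction B₁) (r : R)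
    (x : MonoidAlgebra k Γ₁) : hR.inclusion (B₁.smash r x) =
      B.smash r (MonoidAlgebra.mapDomainAlgHom k k Γ₁.subtype x) :=
  LinearMap.lTensor_tmul _ _ _ _

theorem inclLin_sub_one (B : YDHopfAlgebra k Γ R) (B₁ : YDHopfAlgebra k Γ₁ R) (g : Γ₁) :
    inclLin R Γ₁ (B₁.el 1 g - B₁.el 1 1) = B.el 1 (g : Γ) - B.el 1 1 := by
  rw [map_sub, inclLin_el B B₁, inclLin_el B B₁, Subgroup.coe_one]

/-! ### The projection onto the group algebra of the quotient -/

variable [Γ₁.Normal]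

variable (k R) in
/-- The linear map underlying the projection `r # g ↦ ε(r) [g]`. -/
noncomputable def quotLin (Γ₁ : Subgroup Γ) [Γ₁.Normal] :
    R ⊗[k] MonoidAlgebra k Γ →ₗ[k] MonoidAlgebra k (Γ ⧸ Γ₁) :=
  (TensorProduct.lid k _).toLinearMap ∘ₗ TensorProduct.map (counit (R := k) (A := R))
    (MonoidAlgebra.mapDomainAlgHom k k (QuotientGroup.mk' Γ₁)).toLinearMap

theorem quotLin_el (B : YDHopfAlgebra k Γ R) (r : R) (g : Γ) :
    quotLin k R Γ₁ (B.el r g) =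
      counit (R := k) r • MonoidAlgebra.single (QuotientGroup.mk' Γ₁ g) (1 : k) := by
  simp [quotLin]

/-- The second tensor factor of `Δ(r # g)` is sent to `ε(r₂) [g]`. Colinearity of `ε` makes it
vanish outside degree `1`, so the degree of `r₂` leaves no trace in the first factor. -/
theorem lTensor_quotLin_smashComul (B : YDHopfAlgebra k Γ R) (r : R) (g : Γ) :
    (quotLin k R Γ₁).lTensor _ (B.smashComul (B.el r g)) =
      B.el r g ⊗ₜ MonoidAlgebra.single (QuotientGroup.mk' Γ₁ g) (1 : k) := by
  have h : ∀ t, (quotLin k R Γ₁).lTensor _ (B.auxB g t) =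
      B.el (TensorProduct.rid k R ((counit (R := k) (A := R)).lTensor R t)) g ⊗ₜ
        MonoidAlgebra.single (QuotientGroup.mk' Γ₁ g) (1 : k) := fun t => by
    induction t using YDModule.homog_induction₂ B.toYDModule B.toYDModule with
    | zero => simp
    | add x y hx hy => simp only [map_add, hx, hy, add_tmul]
    | smul a x hx => simp only [map_smul, hx, smul_tmul']
    | tmul d m e n hm hn =>
      rw [auxB_homog _ _ _ hn, LinearMap.lTensor_tmul, quotLin_el]
      rcases B.counit_homog hn with h | rfl
      · simp [h]
      · rw [one_mul, LinearMap.lTensor_tmul, TensorProduct.rid_tmul, tmul_smul, smul_tmul',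
          smul_tmul']
  rw [smashComul_el, h, Coalgebra.lTensor_counit_comul, TensorProduct.rid_tmul, one_smul]

/-- Here the first factor becomes `ε(r₁)` times the coset of `(r₂)₍₋₁₎ g`. This is the coset of `g`
because all degrees of `R` lie in `Γ₁`. -/
theorem IsRestriction.rTensor_quotLin_smashComul (hR : B.IsRestriction B₁) (r : R) (g : Γ) :
    (quotLin k R Γ₁).rTensor _ (B.smashComul (B.el r g)) =
      MonoidAlgebra.single (QuotientGroup.mk' Γ₁ g) (1 : k) ⊗ₜ B.el r g := by
  have h : ∀ t, (quotLin k R Γ₁).rTensor _ (B.auxB g t) =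
      MonoidAlgebra.single (QuotientGroup.mk' Γ₁ g) (1 : k) ⊗ₜ
        B.el (TensorProduct.lid k R ((counit (R := k) (A := R)).rTensor R t)) g := fun t => by
    induction t using YDModule.homog_induction₂ B₁.toYDModule B₁.toYDModule with
    | zero => simp
    | add x y hx hy => simp only [map_add, hx, hy, tmul_add, add_tmul]
    | smul a x hx => simp only [map_smul, hx, ← smul_tmul', tmul_smul]
    | tmul d m e n hm hn =>
      have he : QuotientGroup.mk' Γ₁ (e : Γ) = 1 := (QuotientGroup.eq_one_iff _).2 e.2
      rw [auxB_homog _ _ _ (hR.toYDModule.isHomog hn), LinearMap.rTensor_tmul, quotLin_el, map_mul,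
        he, one_mul, LinearMap.rTensor_tmul, TensorProduct.lid_tmul, ← smul_tmul', ← tmul_smul,
        smul_tmul']
  rw [smashComul_el, h, Coalgebra.rTensor_counit_comul, TensorProduct.lid_tmul, one_smul]

/-- The projection `R # kΓ → k[Γ / Γ₁]`. -/
noncomputable def projection (B : YDHopfAlgebra k Γ R) (Γ₁ : Subgroup Γ) [Γ₁.Normal] :
    B.Bosonization →ₐc[k] MonoidAlgebra k (Γ ⧸ Γ₁) where
  toFun := quotLin k R Γ₁
  map_add' := map_add (quotLin k R Γ₁)
  map_smul' := map_smul (quotLin k R Γ₁)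
  counit_comp := B.ext_el fun r g => by
    change counit (quotLin k R Γ₁ (B.el r g)) = B.smashCounit (B.el r g)
    simp [smashCounit, quotLin_el]
  map_comp_comul := B.ext_el (M := MonoidAlgebra k (Γ ⧸ Γ₁) ⊗[k] MonoidAlgebra k (Γ ⧸ Γ₁))
    fun r g => by
      change TensorProduct.map (quotLin k R Γ₁) (quotLin k R Γ₁) (B.smashComul (B.el r g)) =
        comul (quotLin k R Γ₁ (B.el r g))
      -- Applying the projection to the second factor first reduces the claim to the formula for the
      -- right coaction.
      rw [← LinearMap.rTensor_comp_lTensor, LinearMap.comp_apply, lTensor_quotLin_smashComul,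
        LinearMap.rTensor_tmul, quotLin_el, map_smul, MonoidAlgebra.comul_single,
        ← smul_tmul', CommSemiring.comul_apply, TensorProduct.map_tmul]
      rfl
  map_one' := by
    change quotLin k R Γ₁ (B.el 1 1) = 1
    rw [quotLin_el, B.counit_one, one_smul, map_one, MonoidAlgebra.one_def]
  map_mul' x y := by
    refine LinearMap.congr_fun (f := quotLin k R Γ₁ ∘ₗ B.smashMul)
      (g := LinearMap.mul' k _ ∘ₗ TensorProduct.map (quotLin k R Γ₁) (quotLin k R Γ₁))
      (B.ext_el₂ fun r g s h => ?_) (TensorProduct.tmul k (M := R ⊗[k] MonoidAlgebra k Γ)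
      (N := R ⊗[k] MonoidAlgebra k Γ) x y)
    rw [LinearMap.comp_apply, LinearMap.comp_apply, TensorProduct.map_tmul, smashMul_el,
      LinearMap.mul'_apply, quotLin_el, quotLin_el, quotLin_el, B.counit_mul, counit_act, map_mul]
    simp [mul_comm]

/-! ### Exactness -/

theorem quotLin_surjective (B : YDHopfAlgebra k Γ R) :
    Function.Surjective (quotLin k R Γ₁) := by
  intro y
  -- A preimage comes from the linear section sending a coset `q` to `1 # q.out`.
  refine ⟨((TensorProduct.mk k R _ 1) ∘ₗ YDModule.linearExtension fun q : Γ ⧸ Γ₁ =>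
    MonoidAlgebra.single q.out (1 : k)) y, ?_⟩
  refine LinearMap.congr_fun (f := quotLin k R Γ₁ ∘ₗ (TensorProduct.mk k R _ 1) ∘ₗ
    YDModule.linearExtension fun q : Γ ⧸ Γ₁ => MonoidAlgebra.single q.out (1 : k))
    (g := LinearMap.id) ?_ y
  ext q : 2
  simpa [B.counit_one] using quotLin_el (Γ₁ := Γ₁) B 1 q.out

/-- A subspace of `R # kΓ` containing all `r # g` with `ε(r) = 0` and all `1 # g - 1 # h` with
`g` and `h` congruent modulo `Γ₁` contains the kernel of the projection to `k[Γ / Γ₁]`. -/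
theorem ker_quotLin_le (B : YDHopfAlgebra k Γ R) (N : Submodule k (R ⊗[k] MonoidAlgebra k Γ))
    (h₁ : ∀ r g, counit (R := k) r = 0 → B.el r g ∈ N)
    (h₂ : ∀ g h, QuotientGroup.mk' Γ₁ g = QuotientGroup.mk' Γ₁ h → B.el 1 g - B.el 1 h ∈ N) :
    LinearMap.ker (quotLin k R Γ₁) ≤ N := by
  set σ : MonoidAlgebra k (Γ ⧸ Γ₁) →ₗ[k] R ⊗[k] MonoidAlgebra k Γ :=
    YDModule.linearExtension fun q : Γ ⧸ Γ₁ => B.el 1 q.out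
  -- Modulo `N`, every element equals the section `σ` applied to its image, so an element with image
  -- 0 lies in `N`.
  have h : N.mkQ ∘ₗ σ ∘ₗ quotLin k R Γ₁ = N.mkQ := by
    refine B.ext_el fun r g => ?_
    rw [LinearMap.comp_apply, LinearMap.comp_apply, quotLin_el, map_smul]
    refine ((Submodule.Quotient.eq N).2 ?_).symm
    -- Split `r` into `r - ε(r) 1`, killed by `ε`, and `ε(r) 1`; then replace `g` by the chosen
    -- representative of its coset.
    have e : B.el r g - counit (R := k) r • σ (MonoidAlgebra.single (QuotientGroup.mk' Γ₁ g) 1) =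
        B.el (r - counit (R := k) r • 1) g + counit (R := k) r •
          (B.el 1 g - B.el 1 (QuotientGroup.mk' Γ₁ g).out) := by
      simp only [σ, YDModule.linearExtension_single, one_smul, sub_tmul, smul_sub, smul_tmul']
      abel
    rw [e]
    refine add_mem (h₁ _ _ (by simp [B.counit_one])) (N.smul_mem _ (h₂ _ _ ?_))
    exact (QuotientGroup.out_eq' _).symm
  intro x hx
  have hx' := LinearMap.congr_fun h x
  rw [LinearMap.comp_apply, LinearMap.comp_apply, LinearMap.mem_ker.1 hx, map_zero, map_zero] at hx'
  exact (Submodule.Quotient.mk_eq_zero N).1 hx'.symm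

/-- On `R # kΓ₁` the composite is the counit times `1`, because `Γ₁` becomes trivial in the
quotient. -/
theorem IsRestriction.projection_inclusion (hR : B.IsRestriction B₁) (a : B₁.Bosonization)
    (ha : counit (R := k) a = 0) : B.projection Γ₁ (hR.inclusion a) = 0 := by
  have h : quotLin k R Γ₁ ∘ₗ inclLin R Γ₁ =
      LinearMap.toSpanSingleton k _ 1 ∘ₗ B₁.smashCounit := by
    refine B₁.ext_el fun r g => ?_
    have hg : QuotientGroup.mk' Γ₁ (g : Γ) = 1 := (QuotientGroup.eq_one_iff _).2 g.2
    rw [LinearMap.comp_apply, inclLin_el B B₁, quotLin_el, hg]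
    simp [smashCounit, MonoidAlgebra.one_def]
  have h' := LinearMap.congr_fun h a
  exact h'.trans ((congrArg (LinearMap.toSpanSingleton k _ 1) ha).trans (map_zero _))

theorem counit_el_eq_zero (B : YDHopfAlgebra k Γ R) {r : R} (hr : counit (R := k) r = 0) (g : Γ) :
    B.smashCounit (B.el r g) = 0 := by
  simp [smashCounit, hr]

theorem counit_el_one_sub (B : YDHopfAlgebra k Γ R) (g : Γ) :
    B.smashCounit (B.el 1 g - B.el 1 1) = 0 := by
  simp [smashCounit, B.counit_one]

theorem IsRestriction.ker_eq_left (hR : B.IsRestriction B₁) (c : B.Bosonization) :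
    B.projection Γ₁ c = 0 ↔ c ∈ Submodule.span k {x : B.Bosonization |
      ∃ (c' : B.Bosonization) (a : B₁.Bosonization), counit (R := k) a = 0 ∧
        x = c' * hR.inclusion a} := by
  constructor
  · intro hc
    refine ker_quotLin_le (Γ₁ := Γ₁) B _ (fun r g hr => Submodule.subset_span ?_)
      (fun g h hgh => Submodule.subset_span ?_) hc
    -- Moving `g` to the left of `r` twists by the action: `r # g = (1 # g)(g⁻¹ • r # 1)`.
    · refine ⟨B.el 1 g, B₁.el (B.act g⁻¹ r) 1, B₁.counit_el_eq_zero
        ((B.counit_act g⁻¹ r).trans hr) 1, ?_⟩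
      · change B.el r g = B.smashMul (B.el 1 g ⊗ₜ inclLin R Γ₁ (B₁.el (B.act g⁻¹ r) 1))
        rw [inclLin_el B B₁, smashMul_el, one_mul,
          ← Module.End.mul_apply, ← map_mul]
        simp
    · have hm : h⁻¹ * g ∈ Γ₁ := QuotientGroup.eq.1 hgh.symm
      -- `1 # g - 1 # h = (1 # h)(1 # h⁻¹g - 1 # 1)`.
      refine ⟨B.el 1 h, (B₁.el 1 ⟨_, hm⟩ - B₁.el 1 1 : R ⊗[k] MonoidAlgebra k Γ₁),
        B₁.counit_el_one_sub _, ?_⟩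
      change B.el 1 g - B.el 1 h =
        B.smashMul (B.el 1 h ⊗ₜ inclLin R Γ₁ (B₁.el 1 ⟨_, hm⟩ - B₁.el 1 1))
      rw [inclLin_sub_one B B₁, tmul_sub, map_sub, smashMul_el, smashMul_el, act_one,
        mul_inv_cancel_left, mul_one, mul_one]
  · intro hc
    induction hc using Submodule.span_induction with
    | mem x hx =>
      obtain ⟨c', a, ha, rfl⟩ := hx
      rw [map_mul, hR.projection_inclusion a ha, mul_zero]
    | zero => exact map_zero _
    | add x y _ _ hx hy => rw [map_add, hx, hy, add_zero]
    | smul a x _ hx => rw [map_smul, hx, smul_zero]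

theorem IsRestriction.ker_eq_right (hR : B.IsRestriction B₁) (c : B.Bosonization) :
    B.projection Γ₁ c = 0 ↔ c ∈ Submodule.span k {x : B.Bosonization |
      ∃ (c' : B.Bosonization) (a : B₁.Bosonization), counit (R := k) a = 0 ∧
        x = hR.inclusion a * c'} := by
  constructor
  · intro hc
    refine ker_quotLin_le (Γ₁ := Γ₁) B _ (fun r g hr => Submodule.subset_span ?_)
      (fun g h hgh => Submodule.subset_span ?_) hc
    -- On this side no twist is needed: `r # g = (r # 1)(1 # g)`.
    · refine ⟨B.el 1 g, B₁.el r 1, B₁.counit_el_eq_zero hr 1, ?_⟩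
      change B.el r g = B.smashMul (inclLin R Γ₁ (B₁.el r 1) ⊗ₜ B.el 1 g)
      rw [inclLin_el B B₁, smashMul_el, act_one, mul_one, Subgroup.coe_one, one_mul]
    · have hm : g * h⁻¹ ∈ Γ₁ := by
        rw [← QuotientGroup.eq_one_iff, ← QuotientGroup.mk'_apply, map_mul, map_inv, hgh,
          mul_inv_cancel]
      refine ⟨B.el 1 h, (B₁.el 1 ⟨_, hm⟩ - B₁.el 1 1 : R ⊗[k] MonoidAlgebra k Γ₁),
        B₁.counit_el_one_sub _, ?_⟩
      change B.el 1 g - B.el 1 h =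
        B.smashMul (inclLin R Γ₁ (B₁.el 1 ⟨_, hm⟩ - B₁.el 1 1) ⊗ₜ B.el 1 h)
      rw [inclLin_sub_one B B₁, sub_tmul, map_sub, smashMul_el, smashMul_el, act_one, act_one,
        inv_mul_cancel_right, one_mul, one_mul]
  · intro hc
    induction hc using Submodule.span_induction with
    | mem x hx =>
      obtain ⟨c', a, ha, rfl⟩ := hx
      rw [map_mul, hR.projection_inclusion a ha, zero_mul]
    | zero => exact map_zero _
    | add x y _ _ hx hy => rw [map_add, hx, hy, add_zero]
    | smul a x _ hx => rw [map_smul, hx, smul_zero]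

open Classical in
/-- The coefficient of the neutral element. -/
noncomputable def coeffOne (k : Type u) [Field k] (G : Type v) [Group G] :
    MonoidAlgebra k G →ₗ[k] k :=
  YDModule.linearExtension fun q : G => if q = 1 then (1 : k) else 0

/-- Taking the coefficient of the trivial coset after either coaction is the projection of `R # kΓ`
onto `R # kΓ₁`. A coinvariant element is fixed by it, hence lies in the image of the inclusion. -/
theorem coeffOne_mk_smul_el (B : YDHopfAlgebra k Γ R) (r : R) (g : Γ) :
    coeffOne k (Γ ⧸ Γ₁) (MonoidAlgebra.single (QuotientGroup.mk' Γ₁ g) 1) • B.el r g =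
      inclLin R Γ₁ ((YDModule.proj k Γ₁).lTensor R (B.el r g)) := by
  by_cases hg : g ∈ Γ₁
  · have h1 : QuotientGroup.mk' Γ₁ g = 1 := (QuotientGroup.eq_one_iff _).2 hg
    simp [coeffOne, h1, YDModule.proj_single_mem hg]
  · have h1 : QuotientGroup.mk' Γ₁ g ≠ 1 := fun h => hg ((QuotientGroup.eq_one_iff _).1 h)
    simp only [coeffOne, YDModule.linearExtension_single, h1, if_false, smul_zero, zero_smul,
      LinearMap.lTensor_tmul, YDModule.proj_single_notMem hg, tmul_zero, map_zero]

theorem mem_range_inclLin_iff_lTensor (B : YDHopfAlgebra k Γ R) (B₁ : YDHopfAlgebra k Γ₁ R)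
    (c : R ⊗[k] MonoidAlgebra k Γ) : c ∈ Set.range (inclLin R Γ₁) ↔
      (quotLin k R Γ₁).lTensor (R ⊗[k] MonoidAlgebra k Γ) (B.smashComul c) = c ⊗ₜ 1 := by
  constructor
  · rintro ⟨a, rfl⟩
    refine LinearMap.congr_fun (f := (quotLin k R Γ₁).lTensor _ ∘ₗ B.smashComul ∘ₗ inclLin R Γ₁)
      (g := (TensorProduct.mk k _ _).flip 1 ∘ₗ inclLin R Γ₁) (B₁.ext_el
        (M := (R ⊗[k] MonoidAlgebra k Γ) ⊗[k] MonoidAlgebra k (Γ ⧸ Γ₁)) fun r g => ?_) a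
    have hg : QuotientGroup.mk' Γ₁ (g : Γ) = 1 := (QuotientGroup.eq_one_iff _).2 g.2
    simp only [LinearMap.comp_apply, inclLin_el B B₁, lTensor_quotLin_smashComul, hg,
      LinearMap.flip_apply, TensorProduct.mk_apply, MonoidAlgebra.one_def]
  · intro hc
    refine ⟨(YDModule.proj k Γ₁).lTensor R c, ?_⟩
    -- Evaluated at a coinvariant `c`, the left side is `c` and the right side lies visibly in the
    -- range.
    have h := LinearMap.congr_fun (f := (TensorProduct.rid k _).toLinearMap ∘ₗ
      (coeffOne k (Γ ⧸ Γ₁)).lTensor _ ∘ₗ (quotLin k R Γ₁).lTensor _ ∘ₗ B.smashComul)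
      (g := inclLin R Γ₁ ∘ₗ (YDModule.proj k Γ₁).lTensor R) (B.ext_el fun r g => by
        simp only [LinearMap.comp_apply, lTensor_quotLin_smashComul]
        rw [← coeffOne_mk_smul_el, LinearMap.lTensor_tmul]
        exact TensorProduct.rid_tmul _ _) c
    simp only [LinearMap.comp_apply, hc] at h
    rw [← h]
    simp [coeffOne, MonoidAlgebra.one_def]

theorem IsRestriction.mem_range_inclLin_iff_rTensor (hR : B.IsRestriction B₁)
    (c : R ⊗[k] MonoidAlgebra k Γ) : c ∈ Set.range (inclLin R Γ₁) ↔
      (quotLin k R Γ₁).rTensor (R ⊗[k] MonoidAlgebra k Γ) (B.smashComul c) = 1 ⊗ₜ c := by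
  constructor
  · rintro ⟨a, rfl⟩
    refine LinearMap.congr_fun (f := (quotLin k R Γ₁).rTensor _ ∘ₗ B.smashComul ∘ₗ inclLin R Γ₁)
      (g := TensorProduct.mk k _ _ 1 ∘ₗ inclLin R Γ₁) (B₁.ext_el
        (M := MonoidAlgebra k (Γ ⧸ Γ₁) ⊗[k] (R ⊗[k] MonoidAlgebra k Γ)) fun r g => ?_) a
    have hg : QuotientGroup.mk' Γ₁ (g : Γ) = 1 := (QuotientGroup.eq_one_iff _).2 g.2
    simp only [LinearMap.comp_apply, inclLin_el B B₁, hR.rTensor_quotLin_smashComul, hg,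
      TensorProduct.mk_apply, MonoidAlgebra.one_def]
  · intro hc
    refine ⟨(YDModule.proj k Γ₁).lTensor R c, ?_⟩
    have h := LinearMap.congr_fun (f := (TensorProduct.lid k _).toLinearMap ∘ₗ
      (coeffOne k (Γ ⧸ Γ₁)).rTensor _ ∘ₗ (quotLin k R Γ₁).rTensor _ ∘ₗ B.smashComul)
      (g := inclLin R Γ₁ ∘ₗ (YDModule.proj k Γ₁).lTensor R) (B.ext_el fun r g => by
        simp only [LinearMap.comp_apply, hR.rTensor_quotLin_smashComul]
        rw [← coeffOne_mk_smul_el, LinearMap.rTensor_tmul]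
        exact TensorProduct.lid_tmul _ _) c
    simp only [LinearMap.comp_apply, hc] at h
    rw [← h]
    simp [coeffOne, MonoidAlgebra.one_def]

theorem IsRestriction.isHopfExact (hR : B.IsRestriction B₁) :
    IsHopfExact k hR.inclusion (B.projection Γ₁) where
  injective := by
    refine Function.LeftInverse.injective (g := (YDModule.proj k Γ₁).lTensor R) fun t => ?_
    rw [hR.inclusion_apply, ← LinearMap.comp_apply, ← LinearMap.lTensor_comp,
      YDModule.proj_comp_incl, LinearMap.lTensor_id, LinearMap.id_apply]
  surjective := B.quotLin_surjective
  ker_eq_left := hR.ker_eq_left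
  ker_eq_right := hR.ker_eq_right
  coinv_right := B.mem_range_inclLin_iff_lTensor B₁
  coinv_left := hR.mem_range_inclLin_iff_rTensor

end Extension

end YDHopfAlgebra

theorem mainTheorem9 {k : Type u} {Γ : Type v} {R : Type w} [Field k] [Group Γ] [Finite Γ]
    [Ring R] [Algebra k R] [Coalgebra k R] (B : YDHopfAlgebra k Γ R)
    (hET : B.IsET) (hdim : Module.finrank k (primitives k R) = 2) :
    B.ObtainedFromAbelianCase := by
  have hspan := B.span_homog_closure_primitiveDegrees hET.2
  have hR := B.isRestriction_restrict hspan
  exact ⟨Subgroup.closure B.primitiveDegrees, B.restrict hspan,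
    Γ ⧸ Subgroup.closure B.primitiveDegrees, inferInstance, hR.inclusion, B.projection _,
    -- A subgroup generated by pairwise commuting elements is commutative.
    Subgroup.isMulCommutative_closure fun _ hx _ hy =>
      B.commute_of_mem_primitiveDegrees hdim hx hy,
    hR, hR.inclusion_smash, hR.isHopfExact⟩
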